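/- Let $(M,d)$ be a compact metric space, $\Omega=M^{\mathbb N}$ with elements $x=(x_1,x_2,\dots)$, with the metric $d(x,y)=\sum_{i\ge1}2^{-i}d(x_i,y_i)$ and its Borel $\sigma$-algebra, and let $\sigma(x_1,x_2,\dots)=(x_2,x_3,\dots)$. An a priori probability is a Borel probability $\nu$ on $M$ with support $M$. For a probability $\nu$ on $M$, put $\mathcal L_{A,\nu}f(x)=\int e^{A(a,x_1,x_2,\dots)}f(a,x_1,x_2,\dots)\,d\nu(a)$; $A$ is $\nu$-normalized if $\mathcal L_{A,\nu}1=1$. "Hölder" means Hölder continuous for some exponent in $(0,1]$; in particular Lipschitz functions are Hölder. A $\sigma$-invariant probability $\mu$ on $\Omega$ is an equilibrium probability if there are an a priori probability $\nu$ and a Hölder $\nu$-normalized function $A$ with $\int\mathcal L_{A,\nu}f\,d\mu=\int f\,d\mu$ for all continuous $f:\Omega\to\mathbb R$. For an invariant probability $\eta$, the relative entropy is $h^\nu(\eta)=-\sup\{\int B\,d\eta: B \text{ Lipschitz and } \nu\text{-normalized}\}\in[-\infty,0]$. An invariant probability $\mu$ is a $\nu$-equilibrium probability for $B$ if it attains $\sup_\eta\left(\int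 B\,d\eta+h^\nu(\eta)\right)$, the supremum being over all invariant probabilities $\eta$. Let $P_\mu$ be the law of $x_1$ under $\mu$. For an equilibrium probability $\mu$ and an invariant probability $\eta$, the specific information gain is $$h(\eta,\mu)=\Big[\int B\,d\mu+h^{P_\mu}(\mu)\Big]-\Big[\int B\,d\eta+h^{P_\mu}(\eta)\Big],$$ where $B$ is any Hölder function such that $\mu$ is a $P_\mu$-equilibrium probability for $B$. Let $\hat\sigma(\dots,y_2,y_1|x_1,x_2,\dots)=(\dots,y_2,y_1,x_1|x_2,\dots)$ be the two-sided shift. Let $\mu^-$ be the marginal on the left-infinite sequences of the unique $\hat\sigma$-invariant probability whose marginal on the right-infinite sequences is $\mu$, regarded as a probability on $\Omega$ through $(\dots,y_2,y_1|\mapsto(y_1,y_2,\dots)$. The entropy production is $e_p(\mu)=h(\mu,\mu^-)$. **Proposition.** Let $\mu$ be an equilibrium probability. Then $\mu^-$ is well defined and is an equilibrium probability; the information gains below are well defined (they exist and do not depend on the choice of $B$) and finite; and $$e_p(\mu)=h(\mu,\mu^-)=h(\mu^-,\mu)=e_p(\mu^-).$$ -/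

import Mathlib

open MeasureTheory

noncomputable section

namespace TFCA

/-! One-sided sequences over the alphabet `M` are functions `ℕ → M`; the coordinate `x n` is the
symbol `x_{n+1}`. The product topology and product sigma-algebra are used throughout. -/

/-- The metric `d(x,y) = ∑_{i ≥ 1} d(x_i,y_i) / 2^i` on `M^ℕ` (the series converges if `M` is
bounded, in particular if `M` is compact). -/
def seqDist {M : Type*} [MetricSpace M] (x y : ℕ → M) : ℝ :=
  ∑' n : ℕ, dist (x n) (y n) / 2 ^ (n + 1)

/-- `A` is Hölder continuous with exponent `α` for the metric `seqDist`. -/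
def IsHolderWith {M : Type*} [MetricSpace M] (α : ℝ) (A : (ℕ → M) → ℝ) : Prop :=
  ∃ K : ℝ, ∀ x y : ℕ → M, |A x - A y| ≤ K * seqDist x y ^ α

/-- Lipschitz functions for the metric `seqDist`. -/
def IsLipschitz {M : Type*} [MetricSpace M] (A : (ℕ → M) → ℝ) : Prop :=
  IsHolderWith 1 A

/-- Hölder functions (of some exponent in `(0, 1]`) for the metric `seqDist`. -/
def IsHolder {M : Type*} [MetricSpace M] (A : (ℕ → M) → ℝ) : Prop :=
  ∃ α : ℝ, 0 < α ∧ α ≤ 1 ∧ IsHolderWith α A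

/-- The concatenation `|a, x_1, x_2, ...)`. -/
def cons {M : Type*} (a : M) (x : ℕ → M) : ℕ → M
  | 0 => a
  | n + 1 => x n

/-- The shift `σ`. -/
def shift {M : Type*} (x : ℕ → M) : ℕ → M := fun n => x (n + 1)

/-- Shift-invariant probabilities. -/
def IsInvariantProbability {M : Type*} [MeasurableSpace M] (μ : Measure (ℕ → M)) : Prop :=
  IsProbabilityMeasure μ ∧ MeasurePreserving shift μ μ

/-- A priori probabilities: probabilities on `M` whose support is `M`. -/
def IsAPriori {M : Type*} [MetricSpace M] [MeasurableSpace M] (ν : Measure M) : Prop :=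
  IsProbabilityMeasure ν ∧ ν.support = Set.univ

/-- The Ruelle operator of the potential `A` and the a priori probability `ν`. -/
def ruelle {M : Type*} [MeasurableSpace M] (ν : Measure M) (A f : (ℕ → M) → ℝ) (x : ℕ → M) : ℝ :=
  ∫ a, Real.exp (A (cons a x)) * f (cons a x) ∂ν

/-- `A` is `ν`-normalized: the Ruelle operator fixes the constant function `1`. -/
def IsNormalized {M : Type*} [MeasurableSpace M] (ν : Measure M) (A : (ℕ → M) → ℝ) : Prop :=
  ∀ x : ℕ → M, ruelle ν A (fun _ => 1) x = 1

/-- `μ` is a fixed point of the dual of the Ruelle operator. -/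
def IsDualFixed {M : Type*} [MetricSpace M] [MeasurableSpace M] (ν : Measure M)
    (A : (ℕ → M) → ℝ) (μ : Measure (ℕ → M)) : Prop :=
  ∀ f : (ℕ → M) → ℝ, Continuous f → ∫ x, ruelle ν A f x ∂μ = ∫ x, f x ∂μ

/-- Equilibrium probabilities: invariant probabilities that are fixed by the dual Ruelle operator
of some normalized Hölder potential, for some a priori probability. -/
def IsEquilibriumProbability {M : Type*} [MetricSpace M] [MeasurableSpace M]
    (μ : Measure (ℕ → M)) : Prop :=
  IsInvariantProbability μ ∧
    ∃ ν : Measure M, IsAPriori ν ∧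
      ∃ A : (ℕ → M) → ℝ, IsHolder A ∧ IsNormalized ν A ∧ IsDualFixed ν A μ

/-- The relative entropy `h^ν(μ) = - sup {∫ B dμ : B Lipschitz and ν-normalized}`, a value in
`[-∞, 0]` when `ν` and `μ` are probabilities. -/
def relEntropy {M : Type*} [MetricSpace M] [MeasurableSpace M] (ν : Measure M)
    (μ : Measure (ℕ → M)) : EReal :=
  -(⨆ (B : (ℕ → M) → ℝ) (_ : IsLipschitz B ∧ IsNormalized ν B), ((∫ x, B x ∂μ : ℝ) : EReal))

/-- The pressure `P_ν(A) = sup {∫ A dη + h^ν(η) : η a shift-invariant probability}`. -/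
def pressure {M : Type*} [MetricSpace M] [MeasurableSpace M] (ν : Measure M)
    (A : (ℕ → M) → ℝ) : EReal :=
  ⨆ (η : Measure (ℕ → M)) (_ : IsInvariantProbability η),
    (((∫ x, A x ∂η : ℝ) : EReal) + relEntropy ν η)

/-- `μ` is a `ν`-equilibrium probability for `A`: it is invariant and attains the pressure. -/
def IsEquilibriumFor {M : Type*} [MetricSpace M] [MeasurableSpace M] (ν : Measure M)
    (A : (ℕ → M) → ℝ) (μ : Measure (ℕ → M)) : Prop :=
  IsInvariantProbability μ ∧ ((∫ x, A x ∂μ : ℝ) : EReal) + relEntropy ν μ = pressure ν A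

/-- The projection `P_μ` of `μ` on the first coordinate. -/
def firstMarginal {M : Type*} [MeasurableSpace M] (μ : Measure (ℕ → M)) : Measure M :=
  μ.map (fun x => x 0)

/-- `v` is the specific information gain of `η` with respect to `μ`: there is a Hölder `B` for
which `μ` is the `P_μ`-equilibrium probability, and for every such `B`
`v = [∫ B dμ + h^{P_μ}(μ)] - [∫ B dη + h^{P_μ}(η)]`. -/
def HasInformationGain {M : Type*} [MetricSpace M] [MeasurableSpace M]
    (η μ : Measure (ℕ → M)) (v : EReal) : Prop :=
  (∃ B : (ℕ → M) → ℝ, IsHolder B ∧ IsEquilibriumFor (firstMarginal μ) B μ) ∧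
    ∀ B : (ℕ → M) → ℝ, IsHolder B → IsEquilibriumFor (firstMarginal μ) B μ →
      v = (((∫ x, B x ∂μ : ℝ) : EReal) + relEntropy (firstMarginal μ) μ) -
        (((∫ x, B x ∂η : ℝ) : EReal) + relEntropy (firstMarginal μ) η)

open Classical in
/-- The specific information gain `h(η, μ)`; it has the junk value `⊤` if it is not defined. -/
def informationGain {M : Type*} [MetricSpace M] [MeasurableSpace M]
    (η μ : Measure (ℕ → M)) : EReal :=
  if h : ∃ v : EReal, HasInformationGain η μ v then h.choose else ⊤

/-- The two-sided shift `(..., y_2, y_1 | x_1, x_2, ...) ↦ (..., y_2, y_1, x_1 | x_2, ...)`.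
A left-infinite sequence `(..., y_2, y_1|` is stored as `|y_1, y_2, ...)`, so that the conjugation
between left-infinite and right-infinite sequences is the identity of `ℕ → M`. -/
def biShift {M : Type*} (p : (ℕ → M) × (ℕ → M)) : (ℕ → M) × (ℕ → M) :=
  (cons (p.2 0) p.1, shift p.2)

/-- `m` is an extension of `μ` to a probability invariant under the two-sided shift. -/
def IsInvariantExtension {M : Type*} [MeasurableSpace M] (μ : Measure (ℕ → M))
    (m : Measure ((ℕ → M) × (ℕ → M))) : Prop :=
  IsProbabilityMeasure m ∧ MeasurePreserving biShift m m ∧ m.map Prod.snd = μ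

open Classical in
/-- The time reversal `μ⁻`: the marginal on left-infinite sequences of the unique invariant
extension of `μ`; it has the junk value `0` if there is no unique invariant extension. -/
def timeReversal {M : Type*} [MeasurableSpace M] (μ : Measure (ℕ → M)) : Measure (ℕ → M) :=
  if h : ∃! m : Measure ((ℕ → M) × (ℕ → M)), IsInvariantExtension μ m then
    h.choose.map Prod.fst
  else 0

/-- The entropy production `e_p(μ) = h(μ, μ⁻)`. -/
def entropyProduction {M : Type*} [MetricSpace M] [MeasurableSpace M]
    (μ : Measure (ℕ → M)) : EReal :=
  informationGain μ (timeReversal μ)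

end TFCA

end

open MeasureTheory Filter Topology

noncomputable section

namespace TFCA

set_option linter.unusedSectionVars false

/-! ### The metric on sequences and Hölder functions -/

section SeqDist

variable {M : Type*} [MetricSpace M]

/-! Write `ν = P_μ`. Changing the a priori probability by a density only shifts the potential by a
function of the first symbol, so `μ` is a dual fixed point of a Hölder `ν`-normalized potential `A`.

Information gain. If `B` is continuous and normalized, then `∫ e^(B-A) dμ = 1`, so `e^t - 1 - t ≥ 0`
gives `∫ B dμ ≤ ∫ A dμ`; equality forces `B = A` because `μ` has full support. Hence `h^ν(μ) = -∫ A
dμ`. A Hölder `B` is cohomologous, up to a constant, to a normalized potential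
(`exists_normalized`), and if `μ` is an equilibrium for `B` this potential must be `A`. The choice
of `B` therefore does not matter, and if `η` is a dual fixed point of a Hölder `ν`-normalized `A'`,
then `h(η, μ) = ∫ A' dη - ∫ A dη` (`informationGain_eq`).

Time reversal. The involution kernel gives a Hölder `A'` and a continuous `V` with `A'(ay) + V(ay,x)
= A(ax) + V(y,ax)` and `∫ e^V(y,x) dμ(x) = 1`. Then `A'` is `ν`-normalized. If `θ` is a dual fixed
point of `A'`, the measure `e^V d(θ × μ)` is invariant under the two-sided shift with marginals `θ`
and `μ`. Invariant extensions are unique, so `μ⁻ = θ`, which has the same first marginal `ν`.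

Symmetry. Integrating the kernel identity against the extension cancels `V`, so `∫ A' dθ = ∫ A dμ`;
the swapped extension gives `∫ A' dμ = ∫ A dθ`. Thus `h(μ⁻, μ) = ∫ A' dθ - ∫ A dθ = ∫ A dμ - ∫ A' dμ
= h(μ, μ⁻)`. -/

@[simp] lemma cons_zero (a : M) (x : ℕ → M) : cons a x 0 = a := rfl
@[simp] lemma cons_succ (a : M) (x : ℕ → M) (n : ℕ) : cons a x (n + 1) = x n := rfl
@[simp] lemma shift_cons (a : M) (x : ℕ → M) : shift (cons a x) = x := rfl
lemma cons_shift (x : ℕ → M) : cons (x 0) (shift x) = x := by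
  funext n; cases n <;> rfl

lemma continuous_cons : Continuous fun p : M × (ℕ → M) => cons p.1 p.2 := by
  refine continuous_pi fun n => ?_
  cases n with
  | zero => exact continuous_fst
  | succ n => exact (continuous_apply n).comp continuous_snd

@[fun_prop]
lemma _root_.Continuous.cons' {X : Type*} [TopologicalSpace X] {f : X → M} {g : X → ℕ → M}
    (hf : Continuous f) (hg : Continuous g) : Continuous fun t => cons (f t) (g t) :=
  continuous_cons.comp (hf.prodMk hg)

@[fun_prop]
lemma continuous_shift : Continuous (shift : (ℕ → M) → (ℕ → M)) :=
  continuous_pi fun n => continuous_apply (n + 1)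

lemma seqDist_nonneg (x y : ℕ → M) : 0 ≤ seqDist x y :=
  tsum_nonneg fun _ => by positivity

@[simp] lemma seqDist_self (x : ℕ → M) : seqDist x x = 0 := by simp [seqDist]

lemma seqDist_comm (x y : ℕ → M) : seqDist x y = seqDist y x := by
  simp [seqDist, dist_comm]

variable [CompactSpace M]

variable (M) in
/-- The diameter of the alphabet. -/
def diamBound : ℝ := Metric.diam (Set.univ : Set M)

lemma dist_le_diamBound (a b : M) : dist a b ≤ diamBound M :=
  Metric.dist_le_diam_of_mem isCompact_univ.isBounded trivial trivial

lemma diamBound_nonneg : 0 ≤ diamBound M := Metric.diam_nonneg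

lemma hasSum_diamBound : HasSum (fun n : ℕ => diamBound M / 2 ^ (n + 1)) (diamBound M) := by
  have := hasSum_geometric_two' (diamBound M)
  simpa [div_div, pow_succ, mul_comm] using this

lemma seqDist_term_le (x y : ℕ → M) (n : ℕ) :
    dist (x n) (y n) / 2 ^ (n + 1) ≤ diamBound M / 2 ^ (n + 1) := by
  gcongr; exact dist_le_diamBound _ _

lemma summable_seqDist (x y : ℕ → M) : Summable fun n => dist (x n) (y n) / 2 ^ (n + 1) :=
  Summable.of_nonneg_of_le (fun _ => by positivity) (seqDist_term_le x y)
    hasSum_diamBound.summable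

lemma seqDist_le (x y : ℕ → M) : seqDist x y ≤ diamBound M :=
  ((summable_seqDist x y).tsum_le_tsum (seqDist_term_le x y) hasSum_diamBound.summable).trans
    hasSum_diamBound.tsum_eq.le

lemma seqDist_eq (x y : ℕ → M) :
    seqDist x y = dist (x 0) (y 0) / 2 + seqDist (shift x) (shift y) / 2 := by
  unfold seqDist
  rw [(summable_seqDist x y).tsum_eq_zero_add, ← tsum_div_const]
  simp [shift, pow_succ, div_div]

lemma seqDist_cons (a b : M) (x y : ℕ → M) :
    seqDist (cons a x) (cons b y) = dist a b / 2 + seqDist x y / 2 := by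
  rw [seqDist_eq]; rfl

lemma seqDist_cons_left (a : M) (x y : ℕ → M) :
    seqDist (cons a x) (cons a y) = seqDist x y / 2 := by
  rw [seqDist_cons]; simp

lemma seqDist_shift_le (x y : ℕ → M) : seqDist (shift x) (shift y) ≤ 2 * seqDist x y := by
  have := seqDist_eq x y
  have := dist_nonneg (x := x 0) (y := y 0)
  linarith

lemma dist_zero_le (x y : ℕ → M) : dist (x 0) (y 0) ≤ 2 * seqDist x y := by
  have := seqDist_eq x y
  have := seqDist_nonneg (shift x) (shift y)
  linarith

lemma seqDist_triangle (x y z : ℕ → M) : seqDist x z ≤ seqDist x y + seqDist y z := by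
  unfold seqDist
  rw [← (summable_seqDist x y).tsum_add (summable_seqDist y z)]
  refine (summable_seqDist x z).tsum_le_tsum (fun n => ?_)
    ((summable_seqDist x y).add (summable_seqDist y z))
  rw [← add_div]
  gcongr
  exact dist_triangle _ _ _

lemma continuous_seqDist : Continuous fun p : (ℕ → M) × (ℕ → M) => seqDist p.1 p.2 := by
  refine continuous_tsum (fun n => by fun_prop) (hasSum_diamBound (M := M)).summable fun n p => ?_
  rw [Real.norm_of_nonneg (by positivity)]
  exact seqDist_term_le _ _ _

/-- The topology on sequences is the product topology, not one defined by `seqDist`; continuity of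
`seqDist` links the two. -/
lemma continuous_of_le_seqDist {A : (ℕ → M) → ℝ} {K α : ℝ} (hα : 0 < α)
    (h : ∀ x y, |A x - A y| ≤ K * seqDist x y ^ α) : Continuous A := by
  refine continuous_iff_continuousAt.2 fun y => ?_
  rw [ContinuousAt, tendsto_iff_dist_tendsto_zero]
  have hd : Continuous fun x : ℕ → M => seqDist x y :=
    continuous_seqDist.comp (continuous_id.prodMk continuous_const)
  have hc : Continuous fun x => K * seqDist x y ^ α :=
    continuous_const.mul (hd.rpow_const fun _ => Or.inr hα.le)
  have h0 : Tendsto (fun x => K * seqDist x y ^ α) (𝓝 y) (𝓝 0) := by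
    have := hc.tendsto y
    simpa [Real.zero_rpow hα.ne'] using this
  exact squeeze_zero (fun _ => dist_nonneg) (fun x => by simpa [Real.dist_eq] using h x y) h0

lemma IsHolderWith.continuous {A : (ℕ → M) → ℝ} {α : ℝ} (hα : 0 < α) (h : IsHolderWith α A) :
    Continuous A :=
  let ⟨_, hK⟩ := h; continuous_of_le_seqDist hα hK

lemma IsHolder.continuous {A : (ℕ → M) → ℝ} (h : IsHolder A) : Continuous A :=
  let ⟨_, hα, _, hA⟩ := h; hA.continuous hα

/-- The Hölder constant may be taken nonnegative. -/
lemma IsHolderWith.exists_nonneg {A : (ℕ → M) → ℝ} {α : ℝ} (h : IsHolderWith α A) :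
    ∃ K, 0 ≤ K ∧ ∀ x y : ℕ → M, |A x - A y| ≤ K * seqDist x y ^ α := by
  obtain ⟨K, hK⟩ := h
  refine ⟨max K 0, le_max_right _ _, fun x y => (hK x y).trans ?_⟩
  gcongr
  · exact Real.rpow_nonneg (seqDist_nonneg _ _) _
  · exact le_max_left _ _

lemma rpow_seqDist_le {α β : ℝ} (hβ : 0 < β) (h : β ≤ α) (x y : ℕ → M) :
    seqDist x y ^ α ≤ diamBound M ^ (α - β) * seqDist x y ^ β := by
  rcases (seqDist_nonneg x y).eq_or_lt with h0 | h0
  · rw [← h0, Real.zero_rpow hβ.ne', Real.zero_rpow (hβ.trans_le h).ne', mul_zero]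
  · calc seqDist x y ^ α = seqDist x y ^ (α - β) * seqDist x y ^ β := by
          rw [← Real.rpow_add h0]; ring_nf
      _ ≤ _ := by
          gcongr
          exact seqDist_le x y

lemma IsHolderWith.mono {A : (ℕ → M) → ℝ} {α β : ℝ} (hβ : 0 < β) (h : β ≤ α)
    (hA : IsHolderWith α A) : IsHolderWith β A := by
  obtain ⟨K, hK0, hK⟩ := hA.exists_nonneg
  refine ⟨K * diamBound M ^ (α - β), fun x y => (hK x y).trans ?_⟩
  rw [mul_assoc]
  gcongr
  exact rpow_seqDist_le hβ h x y

lemma IsHolderWith.add {A B : (ℕ → M) → ℝ} {α : ℝ} (hA : IsHolderWith α A)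
    (hB : IsHolderWith α B) : IsHolderWith α fun x => A x + B x := by
  obtain ⟨K, hK⟩ := hA
  obtain ⟨L, hL⟩ := hB
  refine ⟨K + L, fun x y => ?_⟩
  calc |A x + B x - (A y + B y)| = |(A x - A y) + (B x - B y)| := by ring_nf
    _ ≤ |A x - A y| + |B x - B y| := abs_add_le _ _
    _ ≤ _ := by rw [add_mul]; exact add_le_add (hK x y) (hL x y)

lemma IsHolderWith.neg {A : (ℕ → M) → ℝ} {α : ℝ} (hA : IsHolderWith α A) :
    IsHolderWith α fun x => -A x := by
  obtain ⟨K, hK⟩ := hA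
  refine ⟨K, fun x y => ?_⟩
  rw [← neg_sub', abs_neg]
  exact hK x y

lemma IsHolderWith.sub {A B : (ℕ → M) → ℝ} {α : ℝ} (hA : IsHolderWith α A)
    (hB : IsHolderWith α B) : IsHolderWith α fun x => A x - B x := by
  simpa [sub_eq_add_neg] using hA.add hB.neg

lemma isHolderWith_const (c α : ℝ) : IsHolderWith α fun _ : ℕ → M => c :=
  ⟨0, fun x y => by simp⟩

lemma IsHolderWith.comp_shift {A : (ℕ → M) → ℝ} {α : ℝ} (hα : 0 ≤ α) (hA : IsHolderWith α A) :
    IsHolderWith α fun x => A (shift x) := by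
  obtain ⟨K, hK0, hK⟩ := hA.exists_nonneg
  refine ⟨K * 2 ^ α, fun x y => (hK _ _).trans ?_⟩
  rw [mul_assoc, ← Real.mul_rpow two_pos.le (seqDist_nonneg _ _)]
  gcongr
  exacts [seqDist_nonneg _ _, seqDist_shift_le x y]

end SeqDist

/-! ### The log-Laplace functional -/

section LogSumExp

variable {X : Type*} [TopologicalSpace X] [CompactSpace X] [MeasurableSpace X]
  [OpensMeasurableSpace X]

lemma integrable_of_continuous {μ : Measure X} [IsFiniteMeasure μ] {f : X → ℝ}
    (hf : Continuous f) : Integrable f μ :=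
  hf.integrable_of_hasCompactSupport (HasCompactSupport.of_compactSpace f)

end LogSumExp

/-- The log-Laplace functional `log ∫ exp F dρ`. -/
def lse {X : Type*} [MeasurableSpace X] (ρ : Measure X) (F : X → ℝ) : ℝ :=
  Real.log (∫ a, Real.exp (F a) ∂ρ)

section LogSumExp

variable {X : Type*} [TopologicalSpace X] [CompactSpace X] [MeasurableSpace X]
  [OpensMeasurableSpace X] {ρ : Measure X} [IsProbabilityMeasure ρ] {F G : X → ℝ}

lemma integral_exp_pos' (hF : Continuous F) : 0 < ∫ a, Real.exp (F a) ∂ρ :=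
  integral_exp_pos (integrable_of_continuous (Real.continuous_exp.comp hF))

lemma exp_lse (hF : Continuous F) : Real.exp (lse ρ F) = ∫ a, Real.exp (F a) ∂ρ :=
  Real.exp_log (integral_exp_pos' hF)

lemma lse_le_lse_add (hF : Continuous F) (hG : Continuous G) {ε : ℝ}
    (h : ∀ a, F a ≤ G a + ε) : lse ρ F ≤ lse ρ G + ε := by
  rw [← Real.exp_le_exp, Real.exp_add, exp_lse hF, exp_lse hG, ← integral_mul_const]
  refine integral_mono (integrable_of_continuous (Real.continuous_exp.comp hF))
    ((integrable_of_continuous (Real.continuous_exp.comp hG)).mul_const _) fun a => ?_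
  simpa [← Real.exp_add] using h a

/-- A monotone functional commuting with constants is nonexpansive in the sup norm. All contraction
and Hölder estimates for `logRuelle` rest on this. -/
lemma abs_lse_sub_le (hF : Continuous F) (hG : Continuous G) {ε : ℝ}
    (h : ∀ a, |F a - G a| ≤ ε) : |lse ρ F - lse ρ G| ≤ ε := by
  have h1 := lse_le_lse_add (ρ := ρ) hF hG (ε := ε) fun a => by linarith [(abs_le.1 (h a)).2]
  have h2 := lse_le_lse_add (ρ := ρ) hG hF (ε := ε) fun a => by linarith [(abs_le.1 (h a)).1]
  rw [abs_le]; constructor <;> linarith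

lemma lse_add_const (hF : Continuous F) (c : ℝ) : lse ρ (fun a => F a + c) = lse ρ F + c := by
  refine le_antisymm (lse_le_lse_add (by fun_prop) hF fun a => le_rfl) ?_
  have := lse_le_lse_add (ρ := ρ) hF (G := fun a => F a + c) (by fun_prop) (ε := -c)
    fun a => by simp
  linarith

end LogSumExp

/-! ### Normalizing a potential -/

section Normalize

variable {M : Type*} [MetricSpace M] [CompactSpace M] [MeasurableSpace M] [BorelSpace M]
  {ν : Measure M} {A B : (ℕ → M) → ℝ}

lemma continuous_cons_left (hB : Continuous B) (x : ℕ → M) : Continuous fun a => B (cons a x) :=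
  hB.comp (continuous_id.cons' continuous_const)

variable (ν B) in
/-- The logarithm of the Ruelle operator applied to the constant function `1`. -/
def logRuelle (x : ℕ → M) : ℝ := lse ν fun a => B (cons a x)

lemma logRuelle_sub_le [IsProbabilityMeasure ν] (hA : Continuous A) (hB : Continuous B) {ε : ℝ}
    (h : ∀ x, |A x - B x| ≤ ε) (x : ℕ → M) : |logRuelle ν A x - logRuelle ν B x| ≤ ε :=
  abs_lse_sub_le (continuous_cons_left hA x) (continuous_cons_left hB x) fun _ => h _

/-- Prepending a common symbol halves distances; this gain of `2^(-α)` keeps Hölder constants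
bounded under iteration. -/
lemma abs_logRuelle_sub_le [IsProbabilityMeasure ν] {K α : ℝ} (hα : 0 < α)
    (hB : ∀ x y, |B x - B y| ≤ K * seqDist x y ^ α) (x y : ℕ → M) :
    |logRuelle ν B x - logRuelle ν B y| ≤ K * (seqDist x y / 2) ^ α := by
  have hc := continuous_of_le_seqDist hα hB
  refine abs_lse_sub_le (continuous_cons_left hc x) (continuous_cons_left hc y) fun a => ?_
  have := hB (cons a x) (cons a y)
  rwa [seqDist_cons_left] at this

lemma IsHolderWith.logRuelle [IsProbabilityMeasure ν] {α : ℝ} (hα : 0 < α)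
    (hB : IsHolderWith α B) : IsHolderWith α (logRuelle ν B) := by
  obtain ⟨K, hK⟩ := hB
  refine ⟨K * (1 / 2) ^ α, fun x y => (abs_logRuelle_sub_le hα hK x y).trans_eq ?_⟩
  rw [div_eq_mul_one_div, Real.mul_rpow (seqDist_nonneg _ _) (by norm_num)]
  ring

lemma isNormalized_iff : IsNormalized ν A ↔ ∀ x, ∫ a, Real.exp (A (cons a x)) ∂ν = 1 := by
  simp [IsNormalized, ruelle]

lemma IsNormalized.logRuelle (h : IsNormalized ν A) (x : ℕ → M) : logRuelle ν A x = 0 := by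
  simp [TFCA.logRuelle, lse, isNormalized_iff.1 h x]

/-- Subtracting `u ∘ σ - u + c` normalizes `B` if `e^u` is an eigenfunction. -/
lemma isNormalized_of_eigenfunction [IsProbabilityMeasure ν] (hB : Continuous B)
    {u v : (ℕ → M) → ℝ} (hu : Continuous u)
    (h : ∀ x, logRuelle ν (fun x => B x + u x) x = v x) :
    IsNormalized ν fun x => B x + u x - v (shift x) := by
  rw [isNormalized_iff]
  intro x
  have hc : Continuous fun a => B (cons a x) + u (cons a x) :=
    continuous_cons_left (B := fun x => B x + u x) (hB.add hu) x
  have h1 := lse_add_const (ρ := ν) hc (-v x)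
  rw [show lse ν (fun a => B (cons a x) + u (cons a x)) = v x from h x, add_neg_cancel] at h1
  have h2 := exp_lse (ρ := ν) (hc.add_const (-v x))
  rw [h1, Real.exp_zero] at h2
  simpa [sub_eq_add_neg] using h2.symm

lemma isNormalized_sub_logRuelle [IsProbabilityMeasure ν] (hB : Continuous B) :
    IsNormalized ν fun x => B x - logRuelle ν B (shift x) := by
  simpa using isNormalized_of_eigenfunction (ν := ν) hB (u := fun _ => 0) continuous_const
    (v := logRuelle ν B) (fun x => by simp)

end Normalize

/-! ### Tilted measures, the Ruelle operator and its dual -/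

section General

lemma measure_ext_of_continuous {X : Type*} [TopologicalSpace X] [CompactSpace X]
    [MeasurableSpace X] [BorelSpace X] [HasOuterApproxClosed X] {μ μ' : Measure X}
    [IsFiniteMeasure μ] [IsFiniteMeasure μ']
    (h : ∀ f : X → ℝ, Continuous f → ∫ x, f x ∂μ = ∫ x, f x ∂μ') : μ = μ' :=
  ext_of_forall_integral_eq_of_IsFiniteMeasure fun f => h f f.continuous

/-- Tilting by a function whose exponential has integral `1`. -/
lemma integral_tilted_of_normalized {X : Type*} [MeasurableSpace X] {μ : Measure X} {w : X → ℝ}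
    (hw : ∫ x, Real.exp (w x) ∂μ = 1) (f : X → ℝ) :
    ∫ x, f x ∂(μ.tilted w) = ∫ x, Real.exp (w x) * f x ∂μ := by
  rw [integral_tilted]; simp [hw]

end General

section Ruelle

variable {M : Type*} [MetricSpace M] [CompactSpace M] [MeasurableSpace M] [BorelSpace M]
  {ν : Measure M} {A f : (ℕ → M) → ℝ} {μ : Measure (ℕ → M)}

lemma continuous_ruelle [IsFiniteMeasure ν] (hA : Continuous A) (hf : Continuous f) :
    Continuous (ruelle ν A f) := by
  have h : Continuous (Function.uncurry fun (x : ℕ → M) (a : M) =>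
      Real.exp (A (cons a x)) * f (cons a x)) := by
    have hc : Continuous fun p : (ℕ → M) × M => cons p.2 p.1 :=
      continuous_snd.cons' continuous_fst
    exact (Real.continuous_exp.comp (hA.comp hc)).mul (hf.comp hc)
  have := continuous_parametric_integral_of_continuous (μ := ν) h isCompact_univ
  simp only [Measure.restrict_univ] at this
  exact this

lemma continuous_iterate_ruelle [IsFiniteMeasure ν] (hA : Continuous A) (hf : Continuous f)
    (n : ℕ) : Continuous ((ruelle ν A)^[n] f) := by
  induction n with
  | zero => exact hf
  | succ n ih => rw [Function.iterate_succ_apply']; exact continuous_ruelle hA ih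

lemma continuous_logRuelle [IsProbabilityMeasure ν] (hA : Continuous A) :
    Continuous (logRuelle ν A) := by
  have h : Continuous fun x => ∫ a, Real.exp (A (cons a x)) ∂ν :=
    (continuous_ruelle (ν := ν) hA (f := fun _ => 1) continuous_const).congr fun x => by
      simp [ruelle]
  exact Continuous.log h fun x => (integral_exp_pos' (continuous_cons_left hA x)).ne'

variable (ν A μ) in
/-- The dual Ruelle operator, for a normalized potential. -/
def dualRuelle : Measure (ℕ → M) :=
  ((μ.prod ν).tilted fun p => A (cons p.2 p.1)).map fun p => cons p.2 p.1

lemma continuous_cons_swap : Continuous fun p : (ℕ → M) × M => cons p.2 p.1 :=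
  continuous_snd.cons' continuous_fst

lemma integral_dualRuelle [IsProbabilityMeasure ν] [IsProbabilityMeasure μ]
    (hA : Continuous A) (hN : IsNormalized ν A) (hf : Continuous f) :
    ∫ x, f x ∂(dualRuelle ν A μ) = ∫ x, ruelle ν A f x ∂μ := by
  have h1 : ∫ p : (ℕ → M) × M, Real.exp (A (cons p.2 p.1)) ∂(μ.prod ν) = 1 := by
    rw [integral_prod _ (integrable_of_continuous (by fun_prop))]
    simp [isNormalized_iff.1 hN]
  rw [dualRuelle, integral_map continuous_cons_swap.measurable.aemeasurable
    hf.aestronglyMeasurable, integral_tilted_of_normalized h1,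
    integral_prod _ (integrable_of_continuous (by fun_prop))]
  rfl

instance [IsProbabilityMeasure ν] [IsProbabilityMeasure μ] [Fact (Continuous A)] :
    IsProbabilityMeasure (dualRuelle ν A μ) := by
  have hA : Continuous A := Fact.out
  have : IsProbabilityMeasure ((μ.prod ν).tilted fun p => A (cons p.2 p.1)) :=
    isProbabilityMeasure_tilted (integrable_of_continuous (by fun_prop))
  exact Measure.isProbabilityMeasure_map continuous_cons_swap.measurable.aemeasurable

/-- Krylov–Bogolyubov: Cesàro averages of the dual iterates of a Dirac mass have an ultrafilter
limit by compactness, and telescoping bounds the defect of invariance by `2C/(n+1)`. -/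
lemma exists_isDualFixed [Nonempty M] [IsProbabilityMeasure ν] (hA : Continuous A)
    (hN : IsNormalized ν A) : ∃ θ : Measure (ℕ → M), IsProbabilityMeasure θ ∧ IsDualFixed ν A θ := by
  have : Fact (Continuous A) := ⟨hA⟩
  obtain ⟨x₀⟩ := (inferInstance : Nonempty (ℕ → M))
  let m : ℕ → Measure (ℕ → M) := fun k => (dualRuelle ν A)^[k] (Measure.dirac x₀)
  have hm : ∀ k, IsProbabilityMeasure (m k) := fun k => by
    induction k with
    | zero => exact Measure.dirac.isProbabilityMeasure
    | succ k ih => simp only [m, Function.iterate_succ_apply']; infer_instance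
  have hstep : ∀ k (f : (ℕ → M) → ℝ), Continuous f →
      ∫ x, ruelle ν A f x ∂(m k) = ∫ x, f x ∂(m (k + 1)) := fun k f hf => by
    simp only [m, Function.iterate_succ_apply']
    exact (integral_dualRuelle hA hN hf).symm
  let p : ℕ → Measure (ℕ → M) := fun n => ((n : ENNReal) + 1)⁻¹ • ∑ k ∈ Finset.range (n + 1), m k
  have hp : ∀ n, IsProbabilityMeasure (p n) := fun n => ⟨by
    simp only [p, Measure.smul_apply, Measure.finsetSum_apply, measure_univ, Finset.sum_const,
      Finset.card_range, smul_eq_mul, nsmul_eq_mul, mul_one, Nat.cast_add, Nat.cast_one]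
    exact ENNReal.inv_mul_cancel (by simp) (by finiteness)⟩
  have hpi : ∀ n (f : (ℕ → M) → ℝ), Continuous f →
      ∫ x, f x ∂(p n) = ((n : ℝ) + 1)⁻¹ * ∑ k ∈ Finset.range (n + 1), ∫ x, f x ∂(m k) :=
    fun n f hf => by
      simp only [p]
      rw [integral_smul_measure, integral_finsetSum_measure fun k _ =>
        integrable_of_continuous (μ := m k) hf]
      have : ((n : ENNReal) + 1)⁻¹.toReal = ((n : ℝ) + 1)⁻¹ := by
        rw [ENNReal.toReal_inv, ENNReal.toReal_add (by simp) (by simp)]; simp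
      rw [smul_eq_mul, this]
  let q : ℕ → ProbabilityMeasure (ℕ → M) := fun n => ⟨p n, hp n⟩
  let U : Ultrafilter (ProbabilityMeasure (ℕ → M)) := (hyperfilter ℕ).map q
  have hU : Tendsto q (hyperfilter ℕ) (𝓝 U.lim) := U.le_nhds_lim
  rw [ProbabilityMeasure.tendsto_iff_forall_integral_tendsto] at hU
  have hT : ∀ f : (ℕ → M) → ℝ, Continuous f →
      Tendsto (fun n => ∫ x, f x ∂(p n)) (hyperfilter ℕ) (𝓝 (∫ x, f x ∂(U.lim : Measure _))) :=
    fun f hf => hU (BoundedContinuousFunction.mkOfCompact ⟨f, hf⟩)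
  refine ⟨U.lim, inferInstance, fun f hf => ?_⟩
  have hd := (hT _ (continuous_ruelle (ν := ν) hA hf)).sub (hT f hf)
  rw [← sub_eq_zero]
  refine tendsto_nhds_unique hd ?_
  refine Tendsto.mono_left ?_ Nat.hyperfilter_le_atTop
  obtain ⟨C, hC⟩ := isCompact_univ.exists_bound_of_continuousOn hf.continuousOn
  have hb : ∀ k, ‖∫ x, f x ∂(m k)‖ ≤ C := fun k => by
    have := norm_integral_le_of_norm_le_const (μ := m k) (C := C) (f := f)
      (Eventually.of_forall fun x => hC x trivial)
    simpa using this
  have hb2 : ∀ n, ‖∫ x, ruelle ν A f x ∂(p n) - ∫ x, f x ∂(p n)‖ ≤ 2 * C * (1 / ((n : ℝ) + 1)) :=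
    fun n => by
      rw [hpi _ _ (continuous_ruelle hA hf), hpi _ _ hf, ← mul_sub, ← Finset.sum_sub_distrib,
        Finset.sum_congr rfl fun k _ => by rw [hstep k f hf],
        Finset.sum_range_sub fun k => ∫ x, f x ∂(m k), norm_mul, Real.norm_of_nonneg (by positivity),
        mul_comm, one_div]
      gcongr
      calc _ ≤ ‖∫ x, f x ∂(m (n + 1))‖ + ‖∫ x, f x ∂(m 0)‖ := norm_sub_le _ _
        _ ≤ 2 * C := by linarith [hb (n + 1), hb 0]
  refine squeeze_zero_norm hb2 ?_
  simpa using (tendsto_one_div_add_atTop_nhds_zero_nat (𝕜 := ℝ)).const_mul (2 * C)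

/-- Normalization gives `L_A(f ∘ σ) = f`. -/
lemma IsDualFixed.isInvariantProbability [IsProbabilityMeasure μ] (hN : IsNormalized ν A)
    (h : IsDualFixed ν A μ) : IsInvariantProbability μ := by
  refine ⟨inferInstance, continuous_shift.measurable, ?_⟩
  have := Measure.isProbabilityMeasure_map (μ := μ) (continuous_shift (M := M)).measurable.aemeasurable
  refine measure_ext_of_continuous fun f hf => ?_
  rw [integral_map continuous_shift.measurable.aemeasurable hf.aestronglyMeasurable,
    ← h (fun x => f (shift x)) (by fun_prop)]
  congr with x
  have := isNormalized_iff.1 hN x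
  simp [ruelle, integral_mul_const, this]

end Ruelle

/-! ### Full support and the maximum principle -/

section Positivity

variable {M : Type*} [MetricSpace M] [CompactSpace M] [MeasurableSpace M] [BorelSpace M]
  {ν : Measure M} {A f : (ℕ → M) → ℝ} {μ : Measure (ℕ → M)}

lemma IsAPriori.isOpenPosMeasure (h : IsAPriori ν) : ν.IsOpenPosMeasure := by
  refine ⟨fun U hU ⟨x, hx⟩ => ?_⟩
  have hs : x ∈ ν.support := h.2 ▸ trivial
  exact ((Measure.mem_support_iff_forall x).1 hs U (hU.mem_nhds hx)).ne'

lemma eq_zero_of_integral_eq_zero {X : Type*} [TopologicalSpace X] [CompactSpace X]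
    [MeasurableSpace X] [OpensMeasurableSpace X] {ρ : Measure X} [IsFiniteMeasure ρ]
    [ρ.IsOpenPosMeasure] {g : X → ℝ} (hg : Continuous g) (h0 : ∀ x, 0 ≤ g x)
    (h : ∫ x, g x ∂ρ = 0) (x : X) : g x = 0 := by
  have h1 := (integral_eq_zero_iff_of_nonneg h0 (integrable_of_continuous hg)).1 h
  exact congrFun ((hg.ae_eq_iff_eq ρ continuous_zero).1 h1) x

lemma ruelle_nonneg (hf : ∀ x, 0 ≤ f x) (x : ℕ → M) : 0 ≤ ruelle ν A f x :=
  integral_nonneg fun _ => mul_nonneg (Real.exp_pos _).le (hf _)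

lemma iterate_ruelle_nonneg (hf : ∀ x, 0 ≤ f x) (n : ℕ) (x : ℕ → M) :
    0 ≤ (ruelle ν A)^[n] f x := by
  induction n generalizing x with
  | zero => exact hf x
  | succ n ih => rw [Function.iterate_succ_apply']; exact ruelle_nonneg ih x

/-- The first `n` symbols of `y`, followed by `x`. -/
def prefixSeq (n : ℕ) (y x : ℕ → M) : ℕ → M := fun i => if i < n then y i else x (i - n)

lemma prefixSeq_cons (n : ℕ) (y x : ℕ → M) :
    prefixSeq n y (cons (y n) x) = prefixSeq (n + 1) y x := by
  funext i
  rcases lt_trichotomy i n with h | rfl | h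
  · simp [prefixSeq, h, h.trans n.lt_succ_self]
  · simp [prefixSeq]
  · obtain ⟨j, rfl⟩ := Nat.exists_eq_add_of_lt h
    have h1 : n + j + 1 - n = j + 1 := by omega
    have h2 : n + j + 1 - (n + 1) = j := by omega
    simp [prefixSeq, h1, h2, show ¬ (n + j + 1 < n) by omega, show ¬ (n + j < n) by omega]

lemma tendsto_prefixSeq (y : ℕ → M) (x : ℕ → ℕ → M) :
    Tendsto (fun n => prefixSeq n y (x n)) atTop (𝓝 y) := by
  refine tendsto_pi_nhds.2 fun i => tendsto_const_nhds.congr' ?_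
  filter_upwards [eventually_gt_atTop i] with n hn
  simp [prefixSeq, hn]

lemma eq_zero_of_ruelle_eq_zero [IsFiniteMeasure ν] [ν.IsOpenPosMeasure] (hA : Continuous A)
    (hf : Continuous f) (h0 : ∀ x, 0 ≤ f x) {x : ℕ → M} (h : ruelle ν A f x = 0) (a : M) :
    f (cons a x) = 0 := by
  have hc : Continuous fun a => Real.exp (A (cons a x)) * f (cons a x) :=
    continuous_cons_left ((Real.continuous_exp.comp hA).mul hf) x
  have := eq_zero_of_integral_eq_zero hc
    (fun a => mul_nonneg (Real.exp_pos _).le (h0 _)) h a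
  simpa [(Real.exp_pos _).ne'] using this

lemma eq_zero_of_iterate_ruelle_eq_zero [IsFiniteMeasure ν] [ν.IsOpenPosMeasure]
    (hA : Continuous A) (hf : Continuous f) (h0 : ∀ x, 0 ≤ f x) (n : ℕ) {x : ℕ → M}
    (h : (ruelle ν A)^[n] f x = 0) (y : ℕ → M) : f (prefixSeq n y x) = 0 := by
  induction n generalizing x with
  | zero =>
    have : prefixSeq 0 y x = x := by funext i; simp [prefixSeq]
    rw [this]; exact h
  | succ n ih =>
    rw [Function.iterate_succ_apply'] at h
    rw [← prefixSeq_cons]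
    exact ih (eq_zero_of_ruelle_eq_zero hA (continuous_iterate_ruelle hA hf n)
      (iterate_ruelle_nonneg h0 n) h _)

/-- A zero of `L^n f` at `x n` makes `f` vanish at every word of length `n` followed by `x n`; such
points converge to any prescribed `y`. -/
lemma eq_zero_of_forall_exists [IsFiniteMeasure ν] [ν.IsOpenPosMeasure]
    (hA : Continuous A) (hf : Continuous f) (h0 : ∀ x, 0 ≤ f x)
    (h : ∀ n, ∃ x, (ruelle ν A)^[n] f x = 0) (y : ℕ → M) : f y = 0 := by
  choose x hx using h
  have h1 := (hf.tendsto y).comp (tendsto_prefixSeq y x)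
  refine tendsto_nhds_unique h1 (tendsto_const_nhds.congr fun n => ?_)
  exact (eq_zero_of_iterate_ruelle_eq_zero hA hf h0 n (hx n) y).symm

lemma IsDualFixed.integral_iterate [IsFiniteMeasure ν] (hA : Continuous A) (hf : Continuous f)
    (h : IsDualFixed ν A μ) (n : ℕ) : ∫ x, (ruelle ν A)^[n] f x ∂μ = ∫ x, f x ∂μ := by
  induction n with
  | zero => rfl
  | succ n ih =>
    simp only [Function.iterate_succ_apply']
    rw [h _ (continuous_iterate_ruelle hA hf n), ih]

/-- A fixed point of the dual Ruelle operator has full support. -/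
lemma IsDualFixed.eq_zero_of_integral_eq_zero [IsFiniteMeasure ν] [ν.IsOpenPosMeasure]
    [IsProbabilityMeasure μ] (hA : Continuous A) (h : IsDualFixed ν A μ) (hf : Continuous f)
    (h0 : ∀ x, 0 ≤ f x) (hi : ∫ x, f x ∂μ = 0) (y : ℕ → M) : f y = 0 := by
  refine eq_zero_of_forall_exists (ν := ν) hA hf h0 (fun n => ?_) y
  have hn := h.integral_iterate hA hf n
  have := continuous_iterate_ruelle (ν := ν) hA hf n
  rw [hi, integral_eq_zero_iff_of_nonneg (iterate_ruelle_nonneg h0 n)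
    (integrable_of_continuous this)] at hn
  exact hn.exists

/-- A continuous function fixed by a normalized Ruelle operator is constant. -/
lemma eq_of_ruelle_eq [IsFiniteMeasure ν] [ν.IsOpenPosMeasure] (hA : Continuous A)
    (hN : IsNormalized ν A) (hf : Continuous f) (h : ∀ x, ruelle ν A f x = f x) (x y : ℕ → M) :
    f x = f y := by
  obtain ⟨z, -, hz⟩ := isCompact_univ.exists_isMaxOn ⟨x, trivial⟩ hf.continuousOn
  -- Maximum principle: `f z - f` is nonnegative, fixed by the operator, and zero at `z`, so all its
  -- iterates vanish at `z`.
  suffices H : ∀ w, f z - f w = 0 by linarith [H x, H y]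
  have hc : Continuous fun w => f z - f w := continuous_const.sub hf
  have hfix : ruelle ν A (fun w => f z - f w) = fun w => f z - f w := by
    funext w
    have h1 := isNormalized_iff.1 hN w
    have h2 := h w
    unfold ruelle at h2 ⊢
    simp only [mul_sub]
    rw [integral_sub (integrable_of_continuous (by fun_prop))
      (integrable_of_continuous (by fun_prop)), h2, integral_mul_const, h1,
      one_mul]
  refine eq_zero_of_forall_exists (ν := ν) hA hc (fun w => sub_nonneg.2 (hz trivial)) fun n => ⟨z, ?_⟩
  rw [Function.iterate_fixed hfix]; exact sub_self _

end Positivity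

/-! ### Hölder eigenfunctions by vanishing discount -/

section Eigenfunction

variable {M : Type*} [MetricSpace M] [CompactSpace M] [MeasurableSpace M] [BorelSpace M]
  {ν : Measure M} [IsProbabilityMeasure ν] {B : (ℕ → M) → ℝ}

lemma isClosed_holder (C α : ℝ) : IsClosed {u : BoundedContinuousFunction (ℕ → M) ℝ |
    ∀ x y, |u x - u y| ≤ C * seqDist x y ^ α} := by
  simp only [Set.ofPred_forall]
  refine isClosed_iInter fun x => isClosed_iInter fun y => isClosed_le ?_ continuous_const
  have h := fun z : ℕ → M => continuous_eval_const (F := BoundedContinuousFunction (ℕ → M) ℝ) z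
  exact ((h x).sub (h y)).abs

variable (ν) in
/-- The map `u ↦ log L_{B + s u} 1`. -/
def discountedMap (hB : Continuous B) (s : ℝ) (u : BoundedContinuousFunction (ℕ → M) ℝ) :
    BoundedContinuousFunction (ℕ → M) ℝ :=
  BoundedContinuousFunction.mkOfCompact
    ⟨logRuelle ν fun x => B x + s * u x, continuous_logRuelle (by fun_prop)⟩

lemma contractingWith_discountedMap (hB : Continuous B) {s : NNReal} (hs : s < 1) :
    ContractingWith s (discountedMap ν hB s) := by
  refine ⟨hs, LipschitzWith.of_dist_le_mul fun u v => ?_⟩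
  refine (BoundedContinuousFunction.dist_le (by positivity)).2 fun x => ?_
  refine logRuelle_sub_le (A := fun x => B x + s * u x) (B := fun x => B x + s * v x)
    (by fun_prop) (by fun_prop) (fun x => ?_) x
  rw [add_sub_add_left_eq_sub, ← mul_sub, abs_mul, NNReal.abs_eq, ← Real.dist_eq]
  gcongr
  exact BoundedContinuousFunction.dist_coe_le_dist x

/-- `C` is the fixed point of `C ↦ (K + C) 2^(-α)`, so the set of `C`-Hölder functions is preserved,
with the same `C` for every discount `s < 1`. -/
lemma holder_discountedMap {K α : ℝ} (hα : 0 < α)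
    (hB : ∀ x y, |B x - B y| ≤ K * seqDist x y ^ α) (hc : Continuous B) {s : NNReal} (hs : s < 1)
    {C : ℝ} (hC2 : (K + C) * (1 / 2) ^ α = C)
    {u : BoundedContinuousFunction (ℕ → M) ℝ} (hu : ∀ x y, |u x - u y| ≤ C * seqDist x y ^ α)
    (x y : ℕ → M) :
    |discountedMap ν hc s u x - discountedMap ν hc s u y| ≤ C * seqDist x y ^ α := by
  have h : ∀ x y, |B x + s * u x - (B y + s * u y)| ≤ (K + C) * seqDist x y ^ α := fun x y => by
    have hs' : (s : ℝ) ≤ 1 := by exact_mod_cast hs.le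
    calc |B x + s * u x - (B y + s * u y)| = |(B x - B y) + s * (u x - u y)| := by ring_nf
      _ ≤ |B x - B y| + s * |u x - u y| := by
          refine (abs_add_le _ _).trans_eq ?_
          rw [abs_mul, NNReal.abs_eq]
      _ ≤ |B x - B y| + 1 * |u x - u y| := by gcongr
      _ ≤ _ := by linarith [hB x y, hu x y]
  refine (abs_logRuelle_sub_le hα h x y).trans_eq ?_
  rw [div_eq_mul_one_div, Real.mul_rpow (seqDist_nonneg _ _) (by norm_num)]
  linear_combination (seqDist x y ^ α) * hC2

/-- Normalized fixed points of the discounted problem. -/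
lemma exists_discounted {K α : ℝ} (hα : 0 < α)
    (hB : ∀ x y, |B x - B y| ≤ K * seqDist x y ^ α) {s : NNReal} (hs : s < 1)
    {C : ℝ} (hC : 0 ≤ C) (hC2 : (K + C) * (1 / 2) ^ α = C) (x₀ : ℕ → M) :
    ∃ v : BoundedContinuousFunction (ℕ → M) ℝ, (∀ x y, |v x - v y| ≤ C * seqDist x y ^ α) ∧
      v x₀ = 0 ∧ ∀ x, logRuelle ν (fun x => B x + s * v x) x =
        v x + logRuelle ν (fun x => B x + s * v x) x₀ := by
  have hc : Continuous B := continuous_of_le_seqDist hα hB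
  have hT := contractingWith_discountedMap (ν := ν) hc hs
  let u := hT.fixedPoint (discountedMap ν hc s)
  have hfix : discountedMap ν hc s u = u := hT.fixedPoint_isFixedPt
  -- The iterates from `0` stay in the closed Hölder set, hence so does their limit.
  have hu : ∀ x y, |u x - u y| ≤ C * seqDist x y ^ α := by
    refine (isClosed_holder C α).mem_of_tendsto (hT.tendsto_iterate_fixedPoint 0)
      (Eventually.of_forall fun n => ?_)
    induction n with
    | zero =>
      intro x y
      simpa using mul_nonneg hC (Real.rpow_nonneg (seqDist_nonneg x y) α)
    | succ n ih =>
      rw [Function.iterate_succ_apply']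
      exact holder_discountedMap hα hB hc hs hC2 ih
  have hfix' : ∀ x, logRuelle ν (fun x => B x + s * u x) x = u x := fun x =>
    DFunLike.congr_fun hfix x
  -- Subtracting `u x₀` from the argument subtracts only `s * u x₀` from the value, leaving the
  -- additive constant `(1 - s) * u x₀`.
  have key : ∀ x, logRuelle ν (fun x => B x + s * (u x - u x₀)) x = u x - s * u x₀ := fun x => by
    rw [← hfix' x]
    have := lse_add_const (ρ := ν)
      (continuous_cons_left (B := fun x => B x + s * u x) (by fun_prop) x) (-(s * u x₀))
    rw [← sub_eq_add_neg] at this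
    refine Eq.trans ?_ this
    unfold logRuelle
    congr 1
    funext a
    ring
  refine ⟨u - BoundedContinuousFunction.const _ (u x₀), fun x y => ?_, by simp, fun x => ?_⟩
  · simpa using hu x y
  · simp only [BoundedContinuousFunction.coe_sub, Pi.sub_apply,
      BoundedContinuousFunction.const_apply, key]
    ring

/-- Arzelà–Ascoli; vanishing at `x₀` together with the finite diameter supplies the uniform bound.
-/
lemma isCompact_holder (C : ℝ) {α : ℝ} (hα : 0 < α) (hC : 0 ≤ C) (x₀ : ℕ → M) :
    IsCompact {u : BoundedContinuousFunction (ℕ → M) ℝ |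
      (∀ x y, |u x - u y| ≤ C * seqDist x y ^ α) ∧ u x₀ = 0} := by
  refine BoundedContinuousFunction.arzela_ascoli₂
    (Set.Icc (-(C * diamBound M ^ α)) (C * diamBound M ^ α)) isCompact_Icc _ ?_ ?_ ?_
  · exact (isClosed_holder C α).inter
      (isClosed_eq (continuous_eval_const x₀) continuous_const)
  · rintro u x ⟨hu, h0⟩
    have := hu x x₀
    rw [h0, sub_zero] at this
    refine abs_le.1 (this.trans ?_)
    gcongr
    exacts [seqDist_nonneg _ _, seqDist_le _ _]
  · intro y
    rw [Metric.equicontinuousAt_iff_right]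
    intro ε hε
    have hd : Continuous fun x : ℕ → M => C * seqDist y x ^ α :=
      continuous_const.mul ((continuous_seqDist.comp
        (continuous_const.prodMk continuous_id)).rpow_const fun _ => Or.inr hα.le)
    have h0 := hd.tendsto y
    simp only [seqDist_self, Real.zero_rpow hα.ne', mul_zero] at h0
    filter_upwards [h0.eventually_lt_const hε] with x hx u
    rw [Real.dist_eq]
    exact (u.2.1 y x).trans_lt hx

/-- For a Hölder potential the Ruelle operator has a positive Hölder eigenfunction. -/
theorem exists_eigenfunction [Nonempty M] {α : ℝ} (hα : 0 < α) (hB : IsHolderWith α B) :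
    ∃ (u : (ℕ → M) → ℝ) (c : ℝ), IsHolderWith α u ∧
      ∀ x, logRuelle ν (fun x => B x + u x) x = u x + c := by
  obtain ⟨K, hK, hB⟩ := hB.exists_nonneg
  have hc : Continuous B := continuous_of_le_seqDist hα hB
  obtain ⟨x₀⟩ := (inferInstance : Nonempty (ℕ → M))
  have hr : ((1 : ℝ) / 2) ^ α < 1 := Real.rpow_lt_one (by norm_num) (by norm_num) hα
  have hr0 : 0 < ((1 : ℝ) / 2) ^ α := Real.rpow_pos_of_pos (by norm_num) α
  obtain ⟨C, hC, hC2⟩ : ∃ C : ℝ, 0 ≤ C ∧ (K + C) * (1 / 2) ^ α = C := by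
    have h1 : 0 < 1 - ((1 : ℝ) / 2) ^ α := by linarith
    refine ⟨K * (1 / 2) ^ α / (1 - (1 / 2) ^ α), by positivity, ?_⟩
    field_simp
    ring
  let s : ℕ → NNReal := fun n => ((n : NNReal) + 1)⁻¹
  let t : ℕ → NNReal := fun n => 1 - s n
  have hs : Tendsto (fun n => (s n : ℝ)) atTop (𝓝 0) := by
    simpa [s, one_div] using tendsto_one_div_add_atTop_nhds_zero_nat (𝕜 := ℝ)
  have hs1 : ∀ n, s n ≤ 1 := fun n => inv_le_one_of_one_le₀ (by simp)
  have ht1 : ∀ n, t n < 1 := fun n => tsub_lt_self one_pos (by positivity)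
  have ht : Tendsto (fun n => (t n : ℝ)) atTop (𝓝 1) := by
    have := hs.const_sub 1
    simpa [t, NNReal.coe_sub (hs1 _)] using this
  -- The fixed points themselves need not stay bounded as the discount tends to `1`; their recentred
  -- versions lie in one compact set.
  choose v hv using fun n => exists_discounted (ν := ν) hα hB (ht1 n) hC hC2 x₀
  obtain ⟨u, hu, φ, hφ, hlim⟩ := (isCompact_holder C hα hC x₀).tendsto_subseq
    (x := v) fun n => ⟨(hv n).1, (hv n).2.1⟩
  have hsm : Tendsto (fun n => (t (φ n) : ℝ) • v (φ n)) atTop (𝓝 u) := by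
    simpa using (ht.comp hφ.tendsto_atTop).smul hlim
  have hL : ∀ x, Tendsto (fun n => logRuelle ν (fun x => B x + t (φ n) * v (φ n) x) x) atTop
      (𝓝 (logRuelle ν (fun x => B x + u x) x)) := fun x => by
    rw [tendsto_iff_dist_tendsto_zero] at hsm ⊢
    refine squeeze_zero (fun _ => dist_nonneg) (fun n => ?_) hsm
    rw [Real.dist_eq]
    refine logRuelle_sub_le (by fun_prop) (by fun_prop) (fun z => ?_) x
    rw [add_sub_add_left_eq_sub, ← Real.dist_eq]
    exact BoundedContinuousFunction.dist_coe_le_dist (f := (t (φ n) : ℝ) • v (φ n)) (g := u) z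
  refine ⟨u, logRuelle ν (fun x => B x + u x) x₀, ⟨C, hu.1⟩, fun x => ?_⟩
  refine tendsto_nhds_unique (hL x) ?_
  have hev : Tendsto (fun n => v (φ n) x) atTop (𝓝 (u x)) :=
    ((continuous_eval_const x).tendsto u).comp hlim
  exact (hev.add (hL x₀)).congr fun n => ((hv (φ n)).2.2 x).symm

lemma IsInvariantProbability.integral_shift {η : Measure (ℕ → M)}
    (hη : IsInvariantProbability η) {f : (ℕ → M) → ℝ} (hf : Continuous f) :
    ∫ x, f (shift x) ∂η = ∫ x, f x ∂η := by
  conv_rhs => rw [← hη.2.map_eq]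
  rw [integral_map hη.2.aemeasurable hf.aestronglyMeasurable]

/-- A Hölder potential is cohomologous to a normalized one, up to a constant. -/
theorem exists_normalized [Nonempty M] (hB : IsHolder B) :
    ∃ (A : (ℕ → M) → ℝ) (c : ℝ), IsHolder A ∧ IsNormalized ν A ∧
      ∀ η, IsInvariantProbability η → ∫ x, B x ∂η = ∫ x, A x ∂η + c := by
  obtain ⟨α, hα, hα1, hB⟩ := hB
  obtain ⟨u, c, hu, hc⟩ := exists_eigenfunction (ν := ν) hα hB
  have hBc := hB.continuous hα
  have huc := hu.continuous hα
  refine ⟨fun x => B x + u x - (u (shift x) + c), c, ⟨α, hα, hα1, ?_⟩,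
    isNormalized_of_eigenfunction (v := fun x => u x + c) hBc huc hc, fun η hη => ?_⟩
  · exact (hB.add hu).sub ((hu.comp_shift hα.le).add (isHolderWith_const c α))
  · have := hη.1
    rw [integral_sub (integrable_of_continuous (by fun_prop))
      (integrable_of_continuous (by fun_prop)), integral_add (integrable_of_continuous (by fun_prop))
      (integrable_of_continuous (by fun_prop)), integral_add (integrable_of_continuous (by fun_prop))
      (integrable_of_continuous (by fun_prop)), hη.integral_shift huc]
    simp
    ring

end Eigenfunction

/-! ### Relative entropy, equilibrium and information gain -/

section Entropy

variable {M : Type*} [MetricSpace M] [CompactSpace M] [MeasurableSpace M] [BorelSpace M]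
  {ν : Measure M} {A A' B : (ℕ → M) → ℝ} {μ η : Measure (ℕ → M)}

/-- Hölder functions are uniform limits of Lipschitz functions. -/
lemma IsHolder.exists_isLipschitz (hA : IsHolder A) {ε : ℝ} (hε : 0 < ε) :
    ∃ L : (ℕ → M) → ℝ, IsLipschitz L ∧ ∀ x, |L x - A x| ≤ ε := by
  obtain ⟨R, hR⟩ := isCompact_univ.exists_bound_of_continuousOn hA.continuous.continuousOn
  have hR' : ∀ x, |A x| ≤ R := fun x => hR x trivial
  obtain ⟨α, hα, -, K, hK⟩ := hA
  have ht : Tendsto (fun t : ℝ => K * t ^ α) (𝓝 0) (𝓝 0) := by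
    have : Continuous fun t : ℝ => K * t ^ α :=
      continuous_const.mul (Real.continuous_rpow_const hα.le)
    simpa [Real.zero_rpow hα.ne'] using this.tendsto 0
  obtain ⟨δ, hδ, hδ'⟩ := Metric.eventually_nhds_iff.1 (ht.eventually_lt_const hε)
  -- The slope of the inf-convolution: within `δ` the Hölder modulus is below `ε`, and beyond `δ`
  -- the penalty exceeds the oscillation `2|R|`.
  let n : ℝ := 2 * |R| / δ
  have hn : 0 ≤ n := by positivity
  have hlow : ∀ x y, A x - ε ≤ A y + n * seqDist x y := fun x y => by
    have h0 := seqDist_nonneg x y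
    have h1 := (abs_le.1 (hK x y)).2
    rcases lt_or_ge (seqDist x y) δ with h | h
    · have h2 := hδ' (y := seqDist x y) (by rwa [dist_zero_right, Real.norm_of_nonneg h0])
      have : 0 ≤ n * seqDist x y := by positivity
      linarith
    · have h2 : 2 * |R| ≤ n * seqDist x y := by
        calc 2 * |R| = n * δ := by simp only [n]; field_simp
          _ ≤ _ := by gcongr
      have := (abs_le.1 (hR' x)).2
      have := (abs_le.1 (hR' y)).1
      have := le_abs_self R
      linarith
  have hbdd : ∀ x, BddBelow (Set.range fun y => A y + n * seqDist x y) := fun x =>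
    ⟨A x - ε, by rintro _ ⟨y, rfl⟩; exact hlow x y⟩
  refine ⟨fun x => ⨅ y, (A y + n * seqDist x y), ⟨n, fun x y => ?_⟩, fun x => ?_⟩
  · have key : ∀ x y, (⨅ z, (A z + n * seqDist x z)) ≤
        (⨅ z, (A z + n * seqDist y z)) + n * seqDist x y := fun x y => by
      have : Nonempty (ℕ → M) := ⟨x⟩
      rw [← sub_le_iff_le_add]
      refine le_ciInf fun z => ?_
      have h1 := ciInf_le (hbdd x) z
      have h2 := mul_le_mul_of_nonneg_left (seqDist_triangle x y z) hn
      linarith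
    have h1 := key x y
    have h2 := key y x
    rw [seqDist_comm y x] at h2
    rw [Real.rpow_one, abs_le]
    constructor <;> linarith
  · have : Nonempty (ℕ → M) := ⟨x⟩
    have h1 : (⨅ y, (A y + n * seqDist x y)) ≤ A x := by simpa using ciInf_le (hbdd x) x
    have h2 : A x - ε ≤ ⨅ y, (A y + n * seqDist x y) := le_ciInf (hlow x)
    rw [abs_le]
    constructor <;> linarith

lemma IsLipschitz.isHolder (h : IsLipschitz A) : IsHolder A := ⟨1, one_pos, le_rfl, h⟩

/-- Renormalizing an `ε/2`-approximation `L` costs another `ε/2`, because `logRuelle` is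
nonexpansive and vanishes at `A`. -/
lemma exists_isLipschitz_isNormalized [IsProbabilityMeasure ν] (hA : IsHolder A)
    (hN : IsNormalized ν A) {ε : ℝ} (hε : 0 < ε) :
    ∃ B, IsLipschitz B ∧ IsNormalized ν B ∧ ∀ x, |B x - A x| ≤ ε := by
  obtain ⟨L, hL, hLA⟩ := hA.exists_isLipschitz (half_pos hε)
  have hLc := hL.isHolder.continuous
  refine ⟨fun x => L x - logRuelle ν L (shift x),
    IsHolderWith.sub hL ((IsHolderWith.logRuelle one_pos hL).comp_shift zero_le_one),
    isNormalized_sub_logRuelle hLc, fun x => ?_⟩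
  have h1 := logRuelle_sub_le (ν := ν) hLc hA.continuous hLA (shift x)
  rw [hN.logRuelle, sub_zero] at h1
  have h2 := hLA x
  rw [abs_le] at *
  constructor <;> linarith [h1.1, h1.2, h2.1, h2.2]

/-- The supremum runs over Lipschitz potentials only; uniform approximation lets a Hölder potential
compete. -/
lemma relEntropy_le [IsProbabilityMeasure ν] [IsProbabilityMeasure η] (hA : IsHolder A)
    (hN : IsNormalized ν A) : relEntropy ν η ≤ ((-∫ x, A x ∂η : ℝ) : EReal) := by
  rw [relEntropy, EReal.coe_neg, EReal.neg_le_neg_iff]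
  by_contra! hlt
  obtain ⟨r, hr1, hr2⟩ := EReal.lt_iff_exists_real_btwn.1 hlt
  rw [EReal.coe_lt_coe_iff] at hr2
  obtain ⟨B, hB, hBN, hBA⟩ := exists_isLipschitz_isNormalized hA hN (sub_pos.2 hr2)
  have h1 : ∫ x, (A x - (∫ x, A x ∂η - r)) ∂η ≤ ∫ x, B x ∂η :=
    integral_mono (integrable_of_continuous (hA.continuous.sub continuous_const))
      (integrable_of_continuous hB.isHolder.continuous) fun x => by
        have := (abs_le.1 (hBA x)).1
        simp only
        linarith
  rw [integral_sub (integrable_of_continuous hA.continuous) (integrable_const _)] at h1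
  simp only [integral_const, probReal_univ, smul_eq_mul, one_mul, sub_sub_cancel] at h1
  refine absurd (hr1.trans_le (EReal.coe_le_coe_iff.2 h1)) (not_lt.2 ?_)
  exact le_iSup₂ (f := fun (B : (ℕ → M) → ℝ) (_ : IsLipschitz B ∧ IsNormalized ν B) =>
    ((∫ x, B x ∂η : ℝ) : EReal)) B ⟨hB, hBN⟩

/-- `L_A e^(B-A) = L_B 1 = 1`. -/
lemma IsDualFixed.integral_exp_sub [IsProbabilityMeasure μ] (h : IsDualFixed ν A μ)
    (hA : Continuous A) (hB : Continuous B) (hBN : IsNormalized ν B) :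
    ∫ x, Real.exp (B x - A x) ∂μ = 1 := by
  rw [← h _ (by fun_prop)]
  have : ∀ x, ruelle ν A (fun x => Real.exp (B x - A x)) x = 1 := fun x => by
    rw [← isNormalized_iff.1 hBN x]
    unfold ruelle
    congr with a
    rw [← Real.exp_add, add_sub_cancel]
  simp [this]

/-- Writes the Gibbs deficit as the integral of a nonnegative function, which yields both the
inequality and its equality case. -/
lemma IsDualFixed.integral_sub_nonneg [IsProbabilityMeasure μ] (h : IsDualFixed ν A μ)
    (hA : Continuous A) (hB : Continuous B) (hBN : IsNormalized ν B) :
    ∫ x, (Real.exp (B x - A x) - 1 - (B x - A x)) ∂μ = ∫ x, A x ∂μ - ∫ x, B x ∂μ := by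
  rw [integral_sub (integrable_of_continuous (by fun_prop)) (integrable_of_continuous (by fun_prop)),
    integral_sub (integrable_of_continuous (by fun_prop)) (integrable_const _),
    integral_sub (integrable_of_continuous hB) (integrable_of_continuous hA),
    h.integral_exp_sub hA hB hBN]
  simp

lemma exp_sub_one_sub_nonneg (t : ℝ) : 0 ≤ Real.exp t - 1 - t := by
  linarith [Real.add_one_le_exp t]

/-- A fixed point of the dual Ruelle operator of `A` maximizes the integral of `A` among the
normalized potentials. -/
lemma IsDualFixed.integral_le [IsProbabilityMeasure μ] (h : IsDualFixed ν A μ)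
    (hA : Continuous A) (hB : Continuous B) (hBN : IsNormalized ν B) :
    ∫ x, B x ∂μ ≤ ∫ x, A x ∂μ := by
  rw [← sub_nonneg, ← h.integral_sub_nonneg hA hB hBN]
  exact integral_nonneg fun x => exp_sub_one_sub_nonneg _

/-- Full support turns a zero deficit into a pointwise zero of `e^t - 1 - t`, which forces `t = 0`.
-/
lemma IsDualFixed.eq_of_integral_eq [IsFiniteMeasure ν] [ν.IsOpenPosMeasure]
    [IsProbabilityMeasure μ] (h : IsDualFixed ν A μ) (hA : Continuous A) (hB : Continuous B)
    (hBN : IsNormalized ν B) (he : ∫ x, B x ∂μ = ∫ x, A x ∂μ) : B = A := by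
  have h1 := h.integral_sub_nonneg hA hB hBN
  rw [he, sub_self] at h1
  funext x
  have h2 := h.eq_zero_of_integral_eq_zero hA (by fun_prop) (fun x => exp_sub_one_sub_nonneg _) h1 x
  by_contra hne
  have := Real.add_one_lt_exp (sub_ne_zero.2 hne)
  linarith

lemma IsDualFixed.relEntropy_eq [IsProbabilityMeasure ν] [IsProbabilityMeasure μ]
    (h : IsDualFixed ν A μ) (hA : IsHolder A) (hN : IsNormalized ν A) :
    relEntropy ν μ = ((-∫ x, A x ∂μ : ℝ) : EReal) := by
  refine le_antisymm (relEntropy_le hA hN) ?_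
  rw [relEntropy, EReal.coe_neg, EReal.neg_le_neg_iff]
  exact iSup₂_le fun B hB => EReal.coe_le_coe_iff.2
    (h.integral_le hA.continuous hB.1.isHolder.continuous hB.2)

lemma IsDualFixed.isEquilibriumFor [IsProbabilityMeasure ν] [IsProbabilityMeasure μ]
    (h : IsDualFixed ν A μ) (hA : IsHolder A) (hN : IsNormalized ν A) :
    IsEquilibriumFor ν A μ := by
  have hinv := h.isInvariantProbability hN
  refine ⟨hinv, le_antisymm (le_iSup₂ (f := fun (η : Measure (ℕ → M))
    (_ : IsInvariantProbability η) => ((∫ x, A x ∂η : ℝ) : EReal) + relEntropy ν η) μ hinv) ?_⟩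
  rw [h.relEntropy_eq hA hN, ← EReal.coe_add, add_neg_cancel]
  refine iSup₂_le fun η hη => ?_
  have := hη.1
  calc ((∫ x, A x ∂η : ℝ) : EReal) + relEntropy ν η
      ≤ ((∫ x, A x ∂η : ℝ) : EReal) + ((-∫ x, A x ∂η : ℝ) : EReal) :=
        add_le_add_right (relEntropy_le hA hN) _
    _ = _ := by rw [← EReal.coe_add, add_neg_cancel]

/-- An equilibrium probability determines the potential, up to a constant and a coboundary. -/
theorem IsEquilibriumFor.integral_eq [IsProbabilityMeasure ν] [ν.IsOpenPosMeasure]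
    (hB : IsHolder B) (hμB : IsEquilibriumFor ν B μ) (h : IsDualFixed ν A μ) (hA : IsHolder A)
    (hN : IsNormalized ν A) :
    ∃ c : ℝ, ∀ η, IsInvariantProbability η → ∫ x, B x ∂η = ∫ x, A x ∂η + c := by
  have := hμB.1.1
  have : Nonempty M := ⟨(nonempty_of_isProbabilityMeasure μ).some 0⟩
  obtain ⟨A₁, c, hA₁, hN₁, hc⟩ := exists_normalized (ν := ν) hB
  -- As a competitor in the pressure of `B`, `θ` gives the value `c`. That `μ` does at least as well
  -- means `∫ A₁ dμ ≥ ∫ A dμ`, the equality case of Gibbs.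
  obtain ⟨θ, hθ, hfix⟩ := exists_isDualFixed hA₁.continuous hN₁
  have hθinv := hfix.isInvariantProbability hN₁
  have hle : ((∫ x, B x ∂θ : ℝ) : EReal) + relEntropy ν θ ≤
      ((∫ x, B x ∂μ : ℝ) : EReal) + relEntropy ν μ := by
    rw [hμB.2]
    exact le_iSup₂ (f := fun (η : Measure (ℕ → M))
      (_ : IsInvariantProbability η) => ((∫ x, B x ∂η : ℝ) : EReal) + relEntropy ν η) θ hθinv
  rw [hfix.relEntropy_eq hA₁ hN₁, h.relEntropy_eq hA hN, ← EReal.coe_add, ← EReal.coe_add,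
    EReal.coe_le_coe_iff, hc θ hθinv, hc μ hμB.1] at hle
  have heq : A₁ = A := h.eq_of_integral_eq hA.continuous hA₁.continuous hN₁
    (le_antisymm (h.integral_le hA.continuous hA₁.continuous hN₁) (by linarith))
  exact ⟨c, heq ▸ hc⟩

lemma HasInformationGain.informationGain_eq {v : EReal} (h : HasInformationGain η μ v) :
    informationGain η μ = v := by
  have hex : ∃ v, HasInformationGain η μ v := ⟨v, h⟩
  obtain ⟨B, hB, hμB⟩ := h.1
  rw [informationGain, dif_pos hex, h.2 B hB hμB, ← hex.choose_spec.2 B hB hμB]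

/-- For any admissible `B`, the bracket of `μ` is `c` and that of `η` is `∫ A dη + c - ∫ A' dη`, so
`c` cancels. -/
theorem informationGain_eq (hν : IsAPriori (firstMarginal μ))
    (h : IsDualFixed (firstMarginal μ) A μ) (hA : IsHolder A)
    (hN : IsNormalized (firstMarginal μ) A) [IsProbabilityMeasure μ] [IsProbabilityMeasure η]
    (h' : IsDualFixed (firstMarginal μ) A' η) (hA' : IsHolder A')
    (hN' : IsNormalized (firstMarginal μ) A') :
    informationGain η μ = ((∫ x, A' x ∂η - ∫ x, A x ∂η : ℝ) : EReal) := by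
  have := hν.1
  have := hν.isOpenPosMeasure
  refine HasInformationGain.informationGain_eq
    ⟨⟨A, hA, h.isEquilibriumFor hA hN⟩, fun B hB hμB => ?_⟩
  obtain ⟨c, hc⟩ := hμB.integral_eq hB h hA hN
  rw [h.relEntropy_eq hA hN, h'.relEntropy_eq hA' hN', ← EReal.coe_add, ← EReal.coe_add,
    ← EReal.coe_sub, hc μ hμB.1, hc η (h'.isInvariantProbability hN')]
  congr 1
  ring

end Entropy

/-! ### Replacing the a priori probability by the first marginal -/

section FirstMarginal

variable {M : Type*} [MetricSpace M] [CompactSpace M] [MeasurableSpace M] [BorelSpace M]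
  {ν : Measure M} {A : (ℕ → M) → ℝ} {μ : Measure (ℕ → M)}

lemma measurable_zero_apply : Measurable fun x : ℕ → M => x 0 := measurable_pi_apply 0

instance [IsProbabilityMeasure μ] : IsProbabilityMeasure (firstMarginal μ) :=
  Measure.isProbabilityMeasure_map measurable_zero_apply.aemeasurable

lemma ruelle_congr {ν' : Measure M} {A' f : (ℕ → M) → ℝ} {p : M → ℝ}
    (h : ∀ g : M → ℝ, ∫ a, g a ∂ν' = ∫ a, Real.exp (p a) * g a ∂ν)
    (hA : ∀ x, A' x = A x - p (x 0)) : ruelle ν' A' f = ruelle ν A f := by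
  funext x
  unfold ruelle
  rw [h]
  congr with a
  rw [hA, ← mul_assoc, ← Real.exp_add, cons_zero, add_sub_cancel]

/-- The a priori probability of an equilibrium probability may be chosen as its first marginal. -/
theorem IsEquilibriumProbability.firstMarginal (hμ : IsEquilibriumProbability μ) :
    IsAPriori (firstMarginal μ) ∧ ∃ A : (ℕ → M) → ℝ, IsHolder A ∧
      IsNormalized (TFCA.firstMarginal μ) A ∧ IsDualFixed (TFCA.firstMarginal μ) A μ := by
  obtain ⟨⟨hprob, -⟩, ν, hν, A, hA, hN, hfix⟩ := hμ
  have := hν.1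
  have := hν.isOpenPosMeasure
  have hAc := hA.continuous
  obtain ⟨α, hα, hα1, hAα⟩ := hA
  obtain ⟨K, hK0, hK⟩ := hAα.exists_nonneg
  -- Testing the fixed-point equation on functions of the first symbol shows that `e^p` is the
  -- density of `P_μ` with respect to `ν`.
  let p : M → ℝ := fun a => lse μ fun z => A (cons a z)
  have hq : IsHolderWith α fun x : ℕ → M => p (x 0) := ⟨K, fun x y => by
    refine abs_lse_sub_le (by fun_prop) (by fun_prop) fun z => (hK _ _).trans ?_
    gcongr
    · exact seqDist_nonneg _ _
    · rw [seqDist_cons, seqDist_self]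
      linarith [dist_zero_le x y]⟩
  -- Restrict `x ↦ p (x 0)` to constant sequences.
  have hp : Continuous p :=
    (hq.continuous hα).comp (continuous_pi fun _ => continuous_id : Continuous fun a (_ : ℕ) => a)
  have hmarg : ∀ g : M → ℝ, Continuous g →
      ∫ a, g a ∂(TFCA.firstMarginal μ) = ∫ a, Real.exp (p a) * g a ∂ν := fun g hg => by
    rw [TFCA.firstMarginal, integral_map measurable_zero_apply.aemeasurable
      hg.aestronglyMeasurable, ← hfix (fun x => g (x 0)) (by fun_prop)]
    unfold ruelle
    rw [integral_integral_swap (integrable_of_continuous (X := (ℕ → M) × M) (by fun_prop))]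
    congr with a
    simp only [cons_zero]
    rw [integral_mul_const, exp_lse (by fun_prop)]
  have hp1 : ∫ a, Real.exp (p a) ∂ν = 1 := by
    have := hmarg (fun _ => 1) continuous_const
    simpa using this.symm
  have : IsProbabilityMeasure (ν.tilted p) :=
    isProbabilityMeasure_tilted (integrable_of_continuous (by fun_prop))
  have htilt : TFCA.firstMarginal μ = ν.tilted p := measure_ext_of_continuous fun g hg => by
    rw [hmarg g hg, integral_tilted_of_normalized hp1]
  have hint : ∀ g : M → ℝ,
      ∫ a, g a ∂(TFCA.firstMarginal μ) = ∫ a, Real.exp (p a) * g a ∂ν := fun g => by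
    rw [htilt, integral_tilted_of_normalized hp1]
  have hruelle := fun f => ruelle_congr (f := f) hint
    (A := A) (A' := fun x => A x - p (x 0)) fun x => rfl
  have hopen : (TFCA.firstMarginal μ).IsOpenPosMeasure := by
    rw [htilt]
    exact (absolutelyContinuous_tilted
      (integrable_of_continuous (by fun_prop))).isOpenPosMeasure
  refine ⟨⟨inferInstance, Measure.support_eq_univ⟩, fun x => A x - p (x 0),
    ⟨α, hα, hα1, hAα.sub hq⟩, fun x => ?_, fun f hf => ?_⟩
  · rw [hruelle]; exact hN x
  · rw [hruelle]; exact hfix f hf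

end FirstMarginal

/-! ### The involution kernel -/

section InvolutionKernel

variable {M : Type*} [MetricSpace M]

/-- The sequence `|y_n, ..., y_1, x_1, x_2, ...)`. -/
def revCons : ℕ → (ℕ → M) → (ℕ → M) → ℕ → M
  | 0, _, x => x
  | n + 1, y, x => revCons n (shift y) (cons (y 0) x)

lemma revCons_zero (y x : ℕ → M) : revCons 0 y x = x := rfl

lemma revCons_succ (n : ℕ) (y x : ℕ → M) :
    revCons (n + 1) y x = revCons n (shift y) (cons (y 0) x) := rfl

lemma revCons_add (n : ℕ) (y x : ℕ → M) (i : ℕ) : revCons n y x (n + i) = x i := by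
  induction n generalizing y x i with
  | zero => simp [revCons_zero]
  | succ n ih =>
    rw [revCons_succ, show n + 1 + i = n + (i + 1) by ring, ih, cons_succ]

lemma revCons_congr (n : ℕ) (y x x' : ℕ → M) {i : ℕ} (hi : i < n) :
    revCons n y x i = revCons n y x' i := by
  induction n generalizing y x x' with
  | zero => exact absurd hi (Nat.not_lt_zero i)
  | succ n ih =>
    simp only [revCons_succ]
    rcases (Nat.lt_succ_iff.1 hi).lt_or_eq with h | rfl
    · exact ih _ _ _ h
    · have := revCons_add i (shift y) (cons (y 0) x) 0
      have := revCons_add i (shift y) (cons (y 0) x') 0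
      simp_all

lemma prefixSeq_revCons (n : ℕ) (y x b : ℕ → M) :
    prefixSeq n (revCons n y x) b = revCons n y b := by
  funext i
  rcases lt_or_ge i n with h | h
  · simp [prefixSeq, h, revCons_congr n y x b h]
  · obtain ⟨j, rfl⟩ := Nat.exists_eq_add_of_le h
    simp [prefixSeq, revCons_add]

@[fun_prop]
lemma continuous_revCons (n : ℕ) :
    Continuous fun p : (ℕ → M) × (ℕ → M) => revCons n p.1 p.2 := by
  induction n with
  | zero => exact continuous_snd
  | succ n ih =>
    have h : Continuous fun p : (ℕ → M) × (ℕ → M) => (shift p.1, cons (p.1 0) p.2) := by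
      fun_prop
    exact ih.comp h

variable [CompactSpace M]

/-- Reversing `y` in front of `x` expands differences in `y` by at most `2^n` and contracts those in
`x` by `2^n`. -/
lemma seqDist_revCons_le (n : ℕ) (y y' x x' : ℕ → M) :
    seqDist (revCons n y x) (revCons n y' x') ≤ 2 ^ n * seqDist y y' + seqDist x x' / 2 ^ n := by
  induction n generalizing y y' x x' with
  | zero => simpa [revCons_zero] using seqDist_nonneg y y'
  | succ n ih =>
    have h1 := ih (shift y) (shift y') (cons (y 0) x) (cons (y' 0) x')
    have h2 := seqDist_eq y y'
    rw [seqDist_cons] at h1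
    have h3 : dist (y 0) (y' 0) / 2 / 2 ^ n ≤ 2 ^ n * dist (y 0) (y' 0) := by
      rw [div_div]
      calc dist (y 0) (y' 0) / (2 * 2 ^ n) ≤ dist (y 0) (y' 0) / 1 := by
            gcongr
            nlinarith [one_le_pow₀ (M₀ := ℝ) (a := 2) (n := n) (by norm_num)]
        _ ≤ _ := by
            rw [div_one]
            exact le_mul_of_one_le_left dist_nonneg (one_le_pow₀ (by norm_num))
    calc _ ≤ _ := h1
      _ = 2 ^ n * seqDist (shift y) (shift y') + dist (y 0) (y' 0) / 2 / 2 ^ n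
          + seqDist x x' / 2 ^ (n + 1) := by rw [pow_succ]; field_simp; ring
      _ ≤ 2 ^ n * seqDist (shift y) (shift y') + 2 ^ n * dist (y 0) (y' 0)
          + seqDist x x' / 2 ^ (n + 1) := by gcongr
      _ = _ := by rw [h2, pow_succ]; ring

/-- The involution kernel of `A` with base point `b`. -/
def involutionKernel (A : (ℕ → M) → ℝ) (b y x : ℕ → M) : ℝ :=
  ∑' n, (A (revCons (n + 1) y x) - A (revCons (n + 1) y b))

variable {A : (ℕ → M) → ℝ} {K α : ℝ}

lemma abs_sub_revCons_le (hK : 0 ≤ K) (hα : 0 < α)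
    (hA : ∀ x y, |A x - A y| ≤ K * seqDist x y ^ α) (n : ℕ) (y x x' : ℕ → M) :
    |A (revCons n y x) - A (revCons n y x')| ≤ K * seqDist x x' ^ α * ((1 / 2) ^ α) ^ n := by
  have h := seqDist_revCons_le n y y x x'
  rw [seqDist_self, mul_zero, zero_add] at h
  refine (hA _ _).trans ?_
  rw [mul_assoc, Real.rpow_pow_comm (by norm_num), ← Real.mul_rpow (seqDist_nonneg _ _) (by positivity)]
  gcongr
  · exact seqDist_nonneg _ _
  · rw [one_div_pow, mul_one_div]; exact h

lemma half_rpow_lt_one (hα : 0 < α) : ((1 : ℝ) / 2) ^ α < 1 :=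
  Real.rpow_lt_one (by norm_num) (by norm_num) hα

lemma half_rpow_nonneg : 0 ≤ ((1 : ℝ) / 2) ^ α := Real.rpow_nonneg (by norm_num) α

lemma summable_geometric_const (hα : 0 < α) (C : ℝ) :
    Summable fun n : ℕ => C * (((1 : ℝ) / 2) ^ α) ^ (n + 1) :=
  ((summable_nat_add_iff 1).2
    (summable_geometric_of_lt_one half_rpow_nonneg (half_rpow_lt_one hα))).mul_left C

lemma summable_involutionKernel (hK : 0 ≤ K) (hα : 0 < α)
    (hA : ∀ x y, |A x - A y| ≤ K * seqDist x y ^ α) (y x x' : ℕ → M) :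
    Summable fun n => (A (revCons (n + 1) y x) - A (revCons (n + 1) y x')) :=
  Summable.of_norm_bounded (summable_geometric_const hα (K * seqDist x x' ^ α))
    fun n => abs_sub_revCons_le hK hα hA (n + 1) y x x'

/-- The double difference is at most `2K s^α` by comparing in `y`, and at most `2K t^α` by comparing
in `x`. Interpolating as `s^(α/3) t^(2α/3)` gives the second factor enough weight to beat the growth
`2^n` in `s`, leaving the summable `2^(-nα/3)`. -/
lemma abs_sub_sub_revCons_le (hK : 0 ≤ K) (hα : 0 < α)
    (hA : ∀ x y, |A x - A y| ≤ K * seqDist x y ^ α) (n : ℕ) (y y' x x' : ℕ → M) :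
    |(A (revCons n y x) - A (revCons n y x')) - (A (revCons n y' x) - A (revCons n y' x'))| ≤
      2 * K * diamBound M ^ (2 * (α / 3)) * seqDist y y' ^ (α / 3) * ((1 / 2) ^ (α / 3)) ^ n := by
  set Q := |(A (revCons n y x) - A (revCons n y x')) - (A (revCons n y' x) - A (revCons n y' x'))|
  set s := 2 ^ n * seqDist y y' with hs
  set t := diamBound M / 2 ^ n with ht
  have hs0 : 0 ≤ s := mul_nonneg (by positivity) (seqDist_nonneg _ _)
  have ht0 : 0 ≤ t := div_nonneg diamBound_nonneg (by positivity)
  have hQs : Q ≤ 2 * K * s ^ α := by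
    have h : ∀ z, |A (revCons n y z) - A (revCons n y' z)| ≤ K * s ^ α := fun z => by
      refine (hA _ _).trans ?_
      gcongr
      · exact seqDist_nonneg _ _
      · simpa using seqDist_revCons_le n y y' z z
    calc Q = |(A (revCons n y x) - A (revCons n y' x)) -
          (A (revCons n y x') - A (revCons n y' x'))| := by simp only [Q]; ring_nf
      _ ≤ _ := (abs_sub _ _).trans (by linarith [h x, h x'])
  have hQt : Q ≤ 2 * K * t ^ α := by
    have h : ∀ z, |A (revCons n z x) - A (revCons n z x')| ≤ K * t ^ α := fun z => by
      refine (hA _ _).trans ?_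
      gcongr
      · exact seqDist_nonneg _ _
      · have := seqDist_revCons_le n z z x x'
        rw [seqDist_self, mul_zero, zero_add] at this
        refine this.trans ?_
        rw [ht]
        gcongr
        exact seqDist_le _ _
    exact (abs_sub _ _).trans (by linarith [h y, h y'])
  have hm0 : 0 ≤ min s t := le_min hs0 ht0
  have hQm : Q ≤ 2 * K * min s t ^ α := by
    rcases min_choice s t with h | h <;> rw [h] <;> assumption
  calc Q ≤ 2 * K * min s t ^ α := hQm
    _ = 2 * K * (min s t ^ (α / 3) * min s t ^ (2 * (α / 3))) := by
        rw [← Real.rpow_add_of_nonneg hm0 (by positivity) (by positivity)]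
        ring_nf
    _ ≤ 2 * K * (s ^ (α / 3) * t ^ (2 * (α / 3))) := by
        gcongr
        exacts [min_le_left _ _, min_le_right _ _]
    _ = _ := by
        have h2 : (2 : ℝ) ^ n = ((1 / 2) ^ n)⁻¹ := by simp
        have hu : 0 < ((1 : ℝ) / 2) ^ n := by positivity
        have hv : 0 < (((1 : ℝ) / 2) ^ n) ^ (α / 3) := Real.rpow_pos_of_pos hu _
        rw [hs, ht, Real.mul_rpow (by positivity) (seqDist_nonneg _ _), h2, div_inv_eq_mul,
          Real.mul_rpow diamBound_nonneg hu.le, Real.inv_rpow hu.le, two_mul (α / 3),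
          Real.rpow_add hu, Real.rpow_pow_comm (by norm_num)]
        field_simp

lemma involutionKernel_holder (hK : 0 ≤ K) (hα : 0 < α)
    (hA : ∀ x y, |A x - A y| ≤ K * seqDist x y ^ α) (b : ℕ → M) :
    ∃ C, 0 ≤ C ∧ ∀ y y' x x', |involutionKernel A b y x - involutionKernel A b y' x'| ≤
      C * seqDist y y' ^ (α / 3) + C * seqDist x x' ^ (α / 3) := by
  have hβ : 0 < α / 3 := by positivity
  have hsum := fun y x x' => summable_involutionKernel hK hα hA y x x'
  let S := ∑' n : ℕ, 1 * (((1 : ℝ) / 2) ^ (α / 3)) ^ (n + 1)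
  let T := ∑' n : ℕ, 1 * (((1 : ℝ) / 2) ^ α) ^ (n + 1)
  have hS := (summable_geometric_const hβ 1).hasSum
  have hT := (summable_geometric_const hα 1).hasSum
  have hS0 : 0 ≤ S := tsum_nonneg fun n => by have := half_rpow_nonneg (α := α / 3); positivity
  have hT0 : 0 ≤ T := tsum_nonneg fun n => by have := half_rpow_nonneg (α := α); positivity
  have hD := diamBound_nonneg (M := M)
  let C₁ := 2 * K * diamBound M ^ (2 * (α / 3)) * S
  let C₂ := K * diamBound M ^ (α - α / 3) * T
  have hC₁ : 0 ≤ C₁ := by positivity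
  have hC₂ : 0 ≤ C₂ := by positivity
  refine ⟨C₁ + C₂, by positivity, fun y y' x x' => ?_⟩
  have h1 : |involutionKernel A b y x - involutionKernel A b y' x| ≤
      C₁ * seqDist y y' ^ (α / 3) := by
    unfold involutionKernel
    rw [← (hsum y x b).tsum_sub (hsum y' x b), ← Real.norm_eq_abs]
    refine (tsum_of_norm_bounded (hS.mul_left (2 * K * diamBound M ^ (2 * (α / 3)) *
      seqDist y y' ^ (α / 3))) fun n => ?_).trans_eq (by change _ * S = C₁ * seqDist y y' ^ (α / 3); simp only [C₁]; ring)
    rw [one_mul]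
    exact abs_sub_sub_revCons_le hK hα hA (n + 1) y y' x b
  have h2 : |involutionKernel A b y' x - involutionKernel A b y' x'| ≤
      C₂ * seqDist x x' ^ (α / 3) := by
    unfold involutionKernel
    rw [← (hsum y' x b).tsum_sub (hsum y' x' b), ← Real.norm_eq_abs]
    refine (tsum_of_norm_bounded (hT.mul_left (K * (diamBound M ^ (α - α / 3) *
      seqDist x x' ^ (α / 3)))) fun n => ?_).trans_eq (by change _ * T = C₂ * seqDist x x' ^ (α / 3); simp only [C₂]; ring)
    rw [one_mul, sub_sub_sub_cancel_right]
    refine (abs_sub_revCons_le hK hα hA (n + 1) y' x x').trans ?_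
    gcongr
    exact rpow_seqDist_le hβ (by linarith) x x'
  have hy := Real.rpow_nonneg (seqDist_nonneg y y') (α / 3)
  have hx := Real.rpow_nonneg (seqDist_nonneg x x') (α / 3)
  calc _ ≤ _ := abs_sub_le _ (involutionKernel A b y' x) _
    _ ≤ _ := add_le_add h1 h2
    _ ≤ _ := by gcongr <;> linarith

/-- The first term of the series at `cons a y` is `A(ax) - A(ab)`; the remaining terms are those of
the kernel at `y`, with base point `ab` instead of `b`. -/
lemma involutionKernel_cons (hK : 0 ≤ K) (hα : 0 < α)
    (hA : ∀ x y, |A x - A y| ≤ K * seqDist x y ^ α) (b y x : ℕ → M) (a : M) :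
    involutionKernel A b (cons a y) x = A (cons a x) + involutionKernel A b y (cons a x) -
      (A (cons a b) + involutionKernel A b y (cons a b)) := by
  have hsum := fun y x x' => summable_involutionKernel hK hα hA y x x'
  unfold involutionKernel
  rw [(hsum (cons a y) x b).tsum_eq_zero_add, add_sub_add_comm,
    ← (hsum y (cons a x) b).tsum_sub (hsum y (cons a b) b)]
  congr 1
  refine tsum_congr fun n => ?_
  rw [sub_sub_sub_cancel_right]
  rfl

end InvolutionKernel

/-! ### The dual potential -/

section DualPotential

variable {M : Type*} [MetricSpace M] [CompactSpace M] [MeasurableSpace M] [BorelSpace M]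
  {ν : Measure M} {A A' : (ℕ → M) → ℝ} {μ θ : Measure (ℕ → M)}
  {V : (ℕ → M) → (ℕ → M) → ℝ}

lemma continuous_involutionKernel {K α : ℝ} (hK : 0 ≤ K) (hα : 0 < α)
    (hA : ∀ x y, |A x - A y| ≤ K * seqDist x y ^ α) (b : ℕ → M) :
    Continuous fun p : (ℕ → M) × (ℕ → M) => involutionKernel A b p.1 p.2 := by
  obtain ⟨C, -, hC⟩ := involutionKernel_holder hK hα hA b
  have hβ : 0 < α / 3 := by positivity
  refine continuous_iff_continuousAt.2 fun p => ?_
  rw [ContinuousAt, tendsto_iff_dist_tendsto_zero]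
  have hd : Continuous fun q : (ℕ → M) × (ℕ → M) =>
      C * seqDist q.1 p.1 ^ (α / 3) + C * seqDist q.2 p.2 ^ (α / 3) := by
    have h1 : Continuous fun q : (ℕ → M) × (ℕ → M) => seqDist q.1 p.1 :=
      continuous_seqDist.comp (continuous_fst.prodMk continuous_const)
    have h2 : Continuous fun q : (ℕ → M) × (ℕ → M) => seqDist q.2 p.2 :=
      continuous_seqDist.comp (continuous_snd.prodMk continuous_const)
    exact (continuous_const.mul (h1.rpow_const fun _ => Or.inr hβ.le)).add
      (continuous_const.mul (h2.rpow_const fun _ => Or.inr hβ.le))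
  refine squeeze_zero (fun _ => dist_nonneg) (fun q => ?_)
    (by simpa [Real.zero_rpow hβ.ne'] using hd.tendsto p)
  rw [Real.dist_eq]
  exact hC _ _ _ _

/-- The dual potential `A'` of a Hölder potential `A`, together with a normalized involution
kernel `V`. -/
theorem exists_dualPotential [IsProbabilityMeasure μ] (hA : IsHolder A) :
    ∃ (A' : (ℕ → M) → ℝ) (V : (ℕ → M) → (ℕ → M) → ℝ), IsHolder A' ∧
      Continuous (fun p : (ℕ → M) × (ℕ → M) => V p.1 p.2) ∧
      (∀ y, ∫ x, Real.exp (V y x) ∂μ = 1) ∧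
      ∀ a y x, A' (cons a y) + V (cons a y) x = A (cons a x) + V y (cons a x) := by
  obtain ⟨b⟩ := nonempty_of_isProbabilityMeasure μ
  obtain ⟨α, hα, hα1, hAα⟩ := hA
  obtain ⟨K, hK0, hK⟩ := hAα.exists_nonneg
  obtain ⟨C, hC0, hC⟩ := involutionKernel_holder hK0 hα hK b
  have hβ : 0 < α / 3 := by positivity
  have hWc := continuous_involutionKernel hK0 hα hK b
  have hWy : ∀ y, Continuous fun x => involutionKernel A b y x := fun y =>
    hWc.comp (continuous_const.prodMk continuous_id)
  let h : (ℕ → M) → ℝ := fun y => lse μ fun x => involutionKernel A b y x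
  have hh : IsHolderWith (α / 3) h := ⟨C, fun y y' =>
    abs_lse_sub_le (hWy y) (hWy y') fun x => by
      simpa [Real.zero_rpow hβ.ne'] using hC y y' x x⟩
  have hhc := hh.continuous hβ
  have h1 : IsHolderWith (α / 3) fun y : ℕ → M => A (cons (y 0) b) := by
    refine IsHolderWith.mono (α := α) hβ (by linarith) ⟨K, fun y y' => (hK _ _).trans ?_⟩
    gcongr
    · exact seqDist_nonneg _ _
    · rw [seqDist_cons, seqDist_self]
      linarith [dist_zero_le y y']
  have h2 : IsHolderWith (α / 3) fun y : ℕ → M =>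
      involutionKernel A b (shift y) (cons (y 0) b) := by
    refine ⟨C * 2 ^ (α / 3) + C, fun y y' => (hC _ _ _ _).trans ?_⟩
    rw [add_mul, mul_assoc, ← Real.mul_rpow two_pos.le (seqDist_nonneg _ _)]
    gcongr
    · exact seqDist_nonneg _ _
    · exact seqDist_shift_le _ _
    · exact seqDist_nonneg _ _
    · rw [seqDist_cons, seqDist_self]
      linarith [dist_zero_le y y']
  -- The cocycle relation of the kernel determines `A'`; the coboundary `h - h ∘ σ` compensates for
  -- subtracting `h` from the kernel to normalize it.
  refine ⟨fun y => A (cons (y 0) b) + involutionKernel A b (shift y) (cons (y 0) b) + h y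
    - h (shift y), fun y x => involutionKernel A b y x - h y, ⟨α / 3, hβ, by linarith,
    ((h1.add h2).add hh).sub (hh.comp_shift hβ.le)⟩, hWc.sub (hhc.comp continuous_fst),
    fun y => ?_, fun a y x => ?_⟩
  · have h3 := exp_lse (ρ := μ) ((hWy y).add_const (-h y))
    rw [lse_add_const (hWy y), show lse μ (fun x => involutionKernel A b y x) = h y from rfl,
      add_neg_cancel, Real.exp_zero] at h3
    simpa [sub_eq_add_neg] using h3.symm
  · simp only [cons_zero, shift_cons]
    rw [involutionKernel_cons hK0 hα hK b y x a]
    ring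

/-- Since `e^V(ay,·)` has `μ`-integral `1`, `e^A'(ay)` is the `μ`-integral of `e^(A(ax) + V(y,ax))`;
Fubini and the fixed-point property of `μ` finish. -/
lemma isNormalized_dualPotential [IsProbabilityMeasure ν] [IsProbabilityMeasure μ]
    (hA : Continuous A)
    (hV : Continuous fun p : (ℕ → M) × (ℕ → M) => V p.1 p.2)
    (hV1 : ∀ y, ∫ x, Real.exp (V y x) ∂μ = 1)
    (hVA : ∀ a y x, A' (cons a y) + V (cons a y) x = A (cons a x) + V y (cons a x))
    (hfix : IsDualFixed ν A μ) : IsNormalized ν A' := by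
  rw [isNormalized_iff]
  intro y
  have hVy : Continuous (V y) := hV.comp (continuous_const.prodMk continuous_id)
  have hc : Continuous fun p : M × (ℕ → M) => V y (cons p.1 p.2) := hVy.comp (by fun_prop)
  calc ∫ a, Real.exp (A' (cons a y)) ∂ν
      = ∫ a, ∫ x, Real.exp (A (cons a x)) * Real.exp (V y (cons a x)) ∂μ ∂ν := by
        congr with a
        simp_rw [← Real.exp_add, ← hVA, Real.exp_add]
        rw [integral_const_mul, hV1, mul_one]
    _ = ∫ x, ruelle ν A (fun x => Real.exp (V y x)) x ∂μ :=
        integral_integral_swap (integrable_of_continuous (X := M × (ℕ → M)) (by fun_prop))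
    _ = 1 := by rw [hfix _ (by fun_prop), hV1]

/-- The kernel identity makes `x ↦ ∫ e^V(y,x) dθ(y)` a fixed point of `L_A`, hence constant; its
`μ`-mean is `1` by Fubini. -/
lemma integral_exp_kernel_left [IsProbabilityMeasure ν] [ν.IsOpenPosMeasure]
    [IsProbabilityMeasure μ] [IsProbabilityMeasure θ] (hA : Continuous A) (hA' : Continuous A')
    (hV : Continuous fun p : (ℕ → M) × (ℕ → M) => V p.1 p.2)
    (hV1 : ∀ y, ∫ x, Real.exp (V y x) ∂μ = 1)
    (hVA : ∀ a y x, A' (cons a y) + V (cons a y) x = A (cons a x) + V y (cons a x))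
    (hN : IsNormalized ν A) (hθ : IsDualFixed ν A' θ) (x : ℕ → M) :
    ∫ y, Real.exp (V y x) ∂θ = 1 := by
  have hG : Continuous fun x => ∫ y, Real.exp (V y x) ∂θ := by
    have h : Continuous (Function.uncurry fun (x y : ℕ → M) => Real.exp (V y x)) :=
      Real.continuous_exp.comp (hV.comp continuous_swap)
    have := continuous_parametric_integral_of_continuous (μ := θ) h isCompact_univ
    rwa [Measure.restrict_univ] at this
  have hfix : ∀ x, ruelle ν A (fun x => ∫ y, Real.exp (V y x) ∂θ) x = ∫ y, Real.exp (V y x) ∂θ := by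
    intro x
    have hVx : Continuous fun y => V y x := hV.comp (continuous_id.prodMk continuous_const)
    have hc : Continuous fun p : M × (ℕ → M) => V (cons p.1 p.2) x := hVx.comp (by fun_prop)
    calc ruelle ν A (fun x => ∫ y, Real.exp (V y x) ∂θ) x
        = ∫ a, ∫ y, Real.exp (A' (cons a y)) * Real.exp (V (cons a y) x) ∂θ ∂ν := by
          unfold ruelle
          congr with a
          simp_rw [← Real.exp_add, hVA, Real.exp_add]
          rw [integral_const_mul]
      _ = ∫ y, ruelle ν A' (fun y => Real.exp (V y x)) y ∂θ :=
          integral_integral_swap (integrable_of_continuous (X := M × (ℕ → M)) (by fun_prop))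
      _ = _ := hθ _ (by fun_prop)
  have hconst := eq_of_ruelle_eq hA hN hG hfix
  calc ∫ y, Real.exp (V y x) ∂θ = ∫ _x', ∫ y, Real.exp (V y x) ∂θ ∂μ := by simp
    _ = ∫ x', ∫ y, Real.exp (V y x') ∂θ ∂μ := integral_congr_ae (.of_forall fun x' => hconst x x')
    _ = ∫ y, ∫ x', Real.exp (V y x') ∂μ ∂θ := by
        have h : Continuous fun p : (ℕ → M) × (ℕ → M) => Real.exp (V p.2 p.1) :=
          Real.continuous_exp.comp (hV.comp continuous_swap)
        exact integral_integral_swap (integrable_of_continuous h)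
    _ = 1 := by simp [hV1]

end DualPotential

/-! ### The two-sided extension and time reversal -/

section TwoSided

variable {M : Type*} [MetricSpace M] [CompactSpace M] [MeasurableSpace M] [BorelSpace M]
  {ν : Measure M} {A A' : (ℕ → M) → ℝ} {μ θ : Measure (ℕ → M)}
  {V : (ℕ → M) → (ℕ → M) → ℝ} {m m' : Measure ((ℕ → M) × (ℕ → M))}

@[fun_prop]
lemma continuous_biShift : Continuous (biShift : (ℕ → M) × (ℕ → M) → (ℕ → M) × (ℕ → M)) := by
  unfold biShift
  fun_prop

/-- The invariant extension is given by the involution kernel. -/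
theorem exists_isInvariantExtension [IsProbabilityMeasure ν] [ν.IsOpenPosMeasure]
    [IsProbabilityMeasure μ] [IsProbabilityMeasure θ] (hA : Continuous A) (hA' : Continuous A')
    (hV : Continuous fun p : (ℕ → M) × (ℕ → M) => V p.1 p.2)
    (hV1 : ∀ y, ∫ x, Real.exp (V y x) ∂μ = 1)
    (hVA : ∀ a y x, A' (cons a y) + V (cons a y) x = A (cons a x) + V y (cons a x))
    (hN : IsNormalized ν A) (hμ : IsDualFixed ν A μ) (hθ : IsDualFixed ν A' θ) :
    ∃ m, IsInvariantExtension μ m ∧ m.map Prod.fst = θ := by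
  let m := (θ.prod μ).tilted fun p => V p.1 p.2
  have hVe : Continuous fun p : (ℕ → M) × (ℕ → M) => Real.exp (V p.1 p.2) :=
    Real.continuous_exp.comp hV
  have h1 : ∫ p : (ℕ → M) × (ℕ → M), Real.exp (V p.1 p.2) ∂(θ.prod μ) = 1 := by
    rw [integral_prod _ (integrable_of_continuous hVe)]
    simp [hV1]
  have hm : IsProbabilityMeasure m := isProbabilityMeasure_tilted (integrable_of_continuous hVe)
  have hint : ∀ F : (ℕ → M) × (ℕ → M) → ℝ, Continuous F →
      ∫ p, F p ∂m = ∫ y, ∫ x, Real.exp (V y x) * F (y, x) ∂μ ∂θ := fun F hF => by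
    rw [integral_tilted_of_normalized h1, integral_prod _ (integrable_of_continuous (hVe.fun_mul hF))]
  have hintswap : ∀ F : (ℕ → M) × (ℕ → M) → ℝ, Continuous F →
      ∫ p, F p ∂m = ∫ x, ∫ y, Real.exp (V y x) * F (y, x) ∂θ ∂μ := fun F hF => by
    rw [hint F hF]
    exact integral_integral_swap (integrable_of_continuous (hVe.mul hF))
  refine ⟨m, ⟨hm, ⟨continuous_biShift.measurable, ?_⟩, ?_⟩, ?_⟩
  · have := Measure.isProbabilityMeasure_map (μ := m)
      (continuous_biShift (M := M)).measurable.aemeasurable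
    refine measure_ext_of_continuous fun F hF => ?_
    rw [integral_map continuous_biShift.measurable.aemeasurable hF.aestronglyMeasurable,
      hint _ (by fun_prop), hintswap _ hF]
    have hcV : Continuous fun p : ((ℕ → M) × (ℕ → M)) × M => V p.1.1 (cons p.2 p.1.2) :=
      hV.comp (f := fun p : ((ℕ → M) × (ℕ → M)) × M => (p.1.1, cons p.2 p.1.2)) (by fun_prop)
    have hc : Continuous (Function.uncurry fun (p : (ℕ → M) × (ℕ → M)) (a : M) =>
        Real.exp (A (cons a p.2)) * (Real.exp (V p.1 (cons a p.2)) * F (cons a p.1, p.2))) := by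
      simp only [Function.uncurry_def]
      fun_prop
    have hc2 : Continuous fun p : (ℕ → M) × (ℕ → M) =>
        ∫ a, Real.exp (A (cons a p.2)) * (Real.exp (V p.1 (cons a p.2)) * F (cons a p.1, p.2)) ∂ν := by
      have := continuous_parametric_integral_of_continuous (μ := ν) hc isCompact_univ
      rwa [Measure.restrict_univ] at this
    -- The fixed-point property of `μ` exposes the symbol `a` on the right, the kernel identity
    -- moves it to the left, and that of `θ` absorbs it.
    calc ∫ y, ∫ x, Real.exp (V y x) * F (biShift (y, x)) ∂μ ∂θ
        = ∫ y, ∫ x, ∫ a, Real.exp (A (cons a x)) *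
            (Real.exp (V y (cons a x)) * F (cons a y, x)) ∂ν ∂μ ∂θ := by
          congr with y
          have hVy : Continuous (V y) := hV.comp (continuous_const.prodMk continuous_id)
          rw [← hμ _ (by fun_prop)]
          rfl
      _ = ∫ x, ∫ y, ∫ a, Real.exp (A (cons a x)) *
            (Real.exp (V y (cons a x)) * F (cons a y, x)) ∂ν ∂θ ∂μ :=
          integral_integral_swap (integrable_of_continuous hc2)
      _ = ∫ x, ∫ y, ruelle ν A' (fun y => Real.exp (V y x) * F (y, x)) y ∂θ ∂μ := by
          unfold ruelle
          simp_rw [← mul_assoc, ← Real.exp_add, hVA]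
      _ = _ := by
          congr with x
          have hVx : Continuous fun y => V y x := hV.comp (continuous_id.prodMk continuous_const)
          exact hθ _ (by fun_prop)
  · have := Measure.isProbabilityMeasure_map (μ := m)
      (measurable_snd (α := ℕ → M) (β := ℕ → M)).aemeasurable
    refine measure_ext_of_continuous fun f hf => ?_
    rw [integral_map measurable_snd.aemeasurable hf.aestronglyMeasurable, hintswap _ (by fun_prop)]
    simp_rw [integral_mul_const, integral_exp_kernel_left hA hA' hV hV1 hVA hN hθ, one_mul]
  · have := Measure.isProbabilityMeasure_map (μ := m)
      (measurable_fst (α := ℕ → M) (β := ℕ → M)).aemeasurable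
    refine measure_ext_of_continuous fun f hf => ?_
    rw [integral_map measurable_fst.aemeasurable hf.aestronglyMeasurable, hint _ (by fun_prop)]
    simp_rw [integral_mul_const, hV1, one_mul]

lemma iterate_biShift (k : ℕ) (p : (ℕ → M) × (ℕ → M)) :
    biShift^[k] p = (revCons k p.2 p.1, shift^[k] p.2) := by
  induction k generalizing p with
  | zero => rfl
  | succ k ih => rw [Function.iterate_succ_apply, ih]; rfl

lemma continuous_prefixSeq (k : ℕ) (b : ℕ → M) : Continuous fun y => prefixSeq k y b :=
  continuous_pi fun i => by
    by_cases h : i < k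
    · simpa [prefixSeq, h] using continuous_apply i
    · simpa [prefixSeq, h] using continuous_const

/-- Applying the two-sided shift `k` times replaces the first `k` left symbols by symbols of the
right half, so `μ` alone determines the integral. -/
lemma IsInvariantExtension.integral_prefixSeq (h : IsInvariantExtension μ m)
    {f : (ℕ → M) × (ℕ → M) → ℝ} (hf : Continuous f) (k : ℕ) (b : ℕ → M) :
    ∫ p, f (prefixSeq k p.1 b, p.2) ∂m = ∫ x, f (revCons k x b, shift^[k] x) ∂μ := by
  have hk := h.2.1.iterate k
  have hpre := continuous_prefixSeq k b
  have hsh : Continuous (shift^[k] : (ℕ → M) → ℕ → M) := continuous_shift.iterate k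
  have hF : Continuous fun p : (ℕ → M) × (ℕ → M) => f (prefixSeq k p.1 b, p.2) := by fun_prop
  have hg : Continuous fun x : ℕ → M => f (revCons k x b, shift^[k] x) := by
    have : Continuous fun x : ℕ → M => revCons k x b :=
      (continuous_revCons k).comp (continuous_id.prodMk continuous_const)
    fun_prop
  conv_lhs => rw [← hk.map_eq]
  rw [integral_map hk.aemeasurable hF.aestronglyMeasurable]
  conv_rhs => rw [← h.2.2]
  rw [integral_map measurable_snd.aemeasurable hg.aestronglyMeasurable]
  simp_rw [iterate_biShift, prefixSeq_revCons]

/-- Truncating the left half at depth `k` recovers `f` in the limit. The approximating integrals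
depend on `μ` only, whence uniqueness. -/
lemma IsInvariantExtension.tendsto_integral (h : IsInvariantExtension μ m)
    {f : (ℕ → M) × (ℕ → M) → ℝ} (hf : Continuous f) (b : ℕ → M) :
    Tendsto (fun k => ∫ x, f (revCons k x b, shift^[k] x) ∂μ) atTop (𝓝 (∫ p, f p ∂m)) := by
  have := h.1
  obtain ⟨C, hC⟩ := isCompact_univ.exists_bound_of_continuousOn hf.continuousOn
  refine (tendsto_integral_of_dominated_convergence (fun _ => C)
    (F := fun k (p : (ℕ → M) × (ℕ → M)) => f (prefixSeq k p.1 b, p.2)) (fun k => ?_) (integrable_const C)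
    (fun k => .of_forall fun p => hC _ trivial) (.of_forall fun p => ?_)).congr
    fun k => h.integral_prefixSeq hf k b
  · have hpre := continuous_prefixSeq k b
    exact Continuous.aestronglyMeasurable (by fun_prop)
  · exact (hf.tendsto p).comp ((tendsto_prefixSeq p.1 fun _ => b).prodMk_nhds tendsto_const_nhds)

/-- An invariant extension is unique. -/
theorem IsInvariantExtension.unique (h : IsInvariantExtension μ m)
    (h' : IsInvariantExtension μ m') : m = m' := by
  have := h.1
  have := h'.1
  obtain ⟨b, -⟩ := nonempty_of_isProbabilityMeasure m
  exact measure_ext_of_continuous fun f hf =>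
    tendsto_nhds_unique (h.tendsto_integral hf b) (h'.tendsto_integral hf b)

lemma IsInvariantExtension.timeReversal_eq (h : IsInvariantExtension μ m) :
    timeReversal μ = m.map Prod.fst := by
  have hex : ∃! m, IsInvariantExtension μ m := ⟨m, h, fun m' h' => h'.unique h⟩
  rw [timeReversal, dif_pos hex, hex.choose_spec.1.unique h]

/-- Swapping the halves conjugates the two-sided shift to its inverse, stated without naming the
inverse. -/
lemma biShift_swap_biShift (p : (ℕ → M) × (ℕ → M)) : biShift (biShift p).swap = p.swap :=
  Prod.ext (cons_shift p.2) rfl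

lemma IsInvariantExtension.swap (h : IsInvariantExtension μ m) :
    IsInvariantExtension (m.map Prod.fst) (m.map Prod.swap) := by
  have := h.1
  have hb := continuous_biShift (M := M).measurable
  refine ⟨Measure.isProbabilityMeasure_map measurable_swap.aemeasurable, ⟨hb, ?_⟩, ?_⟩
  · conv_lhs => rw [← h.2.1.map_eq]
    rw [Measure.map_map measurable_swap hb, Measure.map_map hb (measurable_swap.comp hb)]
    congr 1
    funext p
    exact biShift_swap_biShift p
  · rw [Measure.map_map measurable_snd measurable_swap]
    rfl

/-- One shift carries `x_1` to the first left symbol, and the extension is shift-invariant. -/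
lemma IsInvariantExtension.firstMarginal_fst (h : IsInvariantExtension μ m) :
    firstMarginal (m.map Prod.fst) = firstMarginal μ := by
  unfold firstMarginal
  have h0 := measurable_zero_apply (M := M)
  conv_lhs => rw [← h.2.1.map_eq]
  conv_rhs => rw [← h.2.2]
  rw [Measure.map_map measurable_fst h.2.1.measurable,
    Measure.map_map h0 (measurable_fst.comp h.2.1.measurable), Measure.map_map h0 measurable_snd]
  rfl

/-- A potential and its dual have the same integral with respect to the two marginals of a
probability that is invariant under the two-sided shift. -/
lemma IsInvariantExtension.integral_dualPotential (h : IsInvariantExtension μ m)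
    (hA : Continuous A) (hA' : Continuous A')
    (hV : Continuous fun p : (ℕ → M) × (ℕ → M) => V p.1 p.2)
    (hVA : ∀ a y x, A' (cons a y) + V (cons a y) x = A (cons a x) + V y (cons a x)) :
    ∫ y, A' y ∂(m.map Prod.fst) = ∫ x, A x ∂μ := by
  have := h.1
  have hc : Continuous fun p : (ℕ → M) × (ℕ → M) => A' p.1 + V p.1 p.2 := by fun_prop
  -- Composed with the shift, `A' + V` becomes `A + V`; by invariance the integrals agree, and the
  -- finite integral of `V` cancels.
  have h1 : ∫ p, (A' p.1 + V p.1 p.2) ∂m = ∫ p, (A p.2 + V p.1 p.2) ∂m := by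
    conv_lhs => rw [← h.2.1.map_eq]
    rw [integral_map h.2.1.aemeasurable hc.aestronglyMeasurable]
    congr with p
    simp only [biShift, hVA, cons_shift]
  rw [integral_add (integrable_of_continuous (by fun_prop)) (integrable_of_continuous hV),
    integral_add (integrable_of_continuous (by fun_prop)) (integrable_of_continuous hV)] at h1
  conv_rhs => rw [← h.2.2]
  rw [integral_map measurable_fst.aemeasurable hA'.aestronglyMeasurable,
    integral_map measurable_snd.aemeasurable hA.aestronglyMeasurable]
  exact add_right_cancel h1

end TwoSided

end TFCA

end

/-! ### Symmetry of the entropy production -/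

theorem mainTheorem6 {M : Type*} [MetricSpace M] [CompactSpace M] [MeasurableSpace M]
    [BorelSpace M] (μ : MeasureTheory.Measure (ℕ → M)) (hμ : TFCA.IsEquilibriumProbability μ) :
    TFCA.IsEquilibriumProbability (TFCA.timeReversal μ) ∧
    (∃ e : ℝ, TFCA.entropyProduction μ = (e : EReal)) ∧
    TFCA.entropyProduction μ = TFCA.informationGain μ (TFCA.timeReversal μ) ∧
    TFCA.informationGain μ (TFCA.timeReversal μ) =
      TFCA.informationGain (TFCA.timeReversal μ) μ ∧
    TFCA.informationGain (TFCA.timeReversal μ) μ =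
      TFCA.entropyProduction (TFCA.timeReversal μ) := by
  have hμp := hμ.1.1
  have hM : Nonempty M := ⟨(MeasureTheory.nonempty_of_isProbabilityMeasure μ).some 0⟩
  obtain ⟨hν, A, hA, hN, hfix⟩ := hμ.firstMarginal
  have := hν.isOpenPosMeasure
  have hAc := hA.continuous
  obtain ⟨A', V, hA', hV, hV1, hVA⟩ := TFCA.exists_dualPotential (μ := μ) hA
  have hAc' := hA'.continuous
  have hN' := TFCA.isNormalized_dualPotential hAc hV hV1 hVA hfix
  obtain ⟨θ, hθ, hfix'⟩ := TFCA.exists_isDualFixed hAc' hN'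
  obtain ⟨m, hm, hmθ⟩ := TFCA.exists_isInvariantExtension hAc hAc' hV hV1 hVA hN hfix hfix'
  have hm' := hm.swap
  have hrev : TFCA.timeReversal μ = θ := hm.timeReversal_eq.trans hmθ
  have hswap : (m.map Prod.swap).map Prod.fst = μ := by
    rw [MeasureTheory.Measure.map_map measurable_fst measurable_swap]
    exact hm.2.2
  have hrev' : TFCA.timeReversal θ = μ := by
    rw [← hmθ, hm'.timeReversal_eq, hswap]
  have hmarg : TFCA.firstMarginal θ = TFCA.firstMarginal μ := by
    rw [← hmθ, hm.firstMarginal_fst]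
  have hint1 := hm.integral_dualPotential hAc hAc' hV hVA
  -- The same kernel is integrated against the swapped extension, giving `∫ A' dμ = ∫ A dθ`.
  have hint2 := hm'.integral_dualPotential hAc hAc' hV hVA
  rw [hmθ] at hint1 hint2
  rw [hswap] at hint2
  have hg1 := TFCA.informationGain_eq hν hfix hA hN hfix' hA' hN'
  have hg2 : TFCA.informationGain μ θ =
      ((∫ x, A x ∂μ - ∫ x, A' x ∂μ : ℝ) : EReal) := by
    -- Because `P_θ = P_μ`, the gain formula also applies with `μ` and `θ` exchanged.
    rw [← hmarg] at hν hfix hN hfix' hN'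
    exact TFCA.informationGain_eq hν hfix' hA' hN' hfix hA hN
  have hsymm : TFCA.informationGain μ θ = TFCA.informationGain θ μ := by
    rw [hg1, hg2, hint1, hint2]
  unfold TFCA.entropyProduction
  rw [hrev, hrev']
  exact ⟨⟨hfix'.isInvariantProbability hN', _, hν, A', hA', hN', hfix'⟩, ⟨_, hg2⟩, rfl, hsymm, rfl⟩
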